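/- **Theorem 3.1 (Trace-form representation).** Let $H$ be a complex separable Hilbert space, and let $\mathcal C$ be a *stable class*: a set of bounded self-adjoint operators on $H$ such that - if $X\in\mathcal C$ and $f:\mathbb R\to\mathbb R$ is bounded and Borel, then $f(X)\in\mathcal C$; - if $X,Y\in\mathcal C$ act on orthogonal subspaces, then their block-diagonal sum $X\oplus Y$ (that is, $X+Y$) lies in $\mathcal C$; - if a monotone sequence in $\mathcal C$ converges strongly to a bounded operator $X$, then $X\in\mathcal C$. Let $\mathcal E:\mathcal C\to[0,\infty]$ satisfy the following axioms. - **A1 (unitary invariance).** For every unitary $U$ and $X\in\mathcal C$: $U^*XU\in\mathcal C$ and $\mathcal E(U^*XU)=\mathcal E(X)$. - **A2 (extensivity).** If $X,Y\in\mathcal C$ act on orthogonal subspaces, then $\mathcal E(X\oplus Y)=\mathcal E(X)+\mathcal E(Y)$. - **A3 (projector-locality).** If $X=\sum_{j=1}^m\lambda_jP_j\in\mathcal C$ with distinct real $\lambda_j$, pairwise orthogonal projections $P_j$, and all $\lambda_jP_j\in\mathcal C$, then $\mathcal E(X)=\sum_{j=1}^m\mathcal E(\lambda_jP_j)$. - **A4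 (dominated continuity).** If $X_n,X,Y\in\mathcal C$ are positive, $X_n\to X$ strongly, $X_n\le Y$ for all $n$, and $\mathcal E(Y)<\infty$, then $\mathcal E(X_n)\to\mathcal E(X)$. - **A5 (normalization).** $I\in\mathcal C$, $0<\mathcal E(I)<\infty$, and for every $t\ge0$: $tI\in\mathcal C$ and $\mathcal E(tI)=t\,\mathcal E(I)$. Let $\mathcal C_1=\mathcal C\cap\mathcal S_1(H)$ be the set of trace-class operators in $\mathcal C$. For $X\in\mathcal C_1$ with positive and negative parts $X_+,X_-$ put $\mathcal E^{\pm}(X):=\mathcal E(X_+)-\mathcal E(X_-)$; thus $\mathcal E^{\pm}(X)=\mathcal E(X)$ if $X\ge0$. Then there are a Borel measurable, nondecreasing $h:\mathbb R\to\mathbb R$ with $h(0)=0$ and a constant $c>0$ such that: 1. for every positive $X\in\mathcal C_1$, $h(X)$ is trace class and $\mathcal E(X)=c\,\operatorname{Tr}(h(X))$; 2. for every self-adjoint (possibly unbounded) operator $D$ on $H$ and every bounded Borel $f:\mathbb R\to\mathbb R$ with $f(D)\in\mathcal C_1$, the operator $h(f(D))$ is trace class, $\mathcal E(f(D)_+)$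 and $\mathcal E(f(D)_-)$ are finite, and $\mathcal E^{\pm}(f(D))=c\,\operatorname{Tr}(h(f(D)))$. Moreover, suppose $\mathcal C_1\ne\{0\}$. If $\tilde h:\mathbb R\to\mathbb R$ is Borel measurable and nondecreasing and $\tilde c>0$ is such that, for all $X\in\mathcal C_1$, $\tilde h(X)$ is trace class and $\mathcal E^{\pm}(X)=\tilde c\,\operatorname{Tr}(\tilde h(X))$, then there are $a>0$ and $b\in\mathbb R$ with $\tilde h=a\,h+b$ and $\tilde c=c/a$. -/

import Mathlib

open Filter Topology MeasureTheory
open scoped ENNReal InnerProductSpace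

noncomputable section

variable {H : Type*} [NormedAddCommGroup H] [InnerProductSpace ℂ H] [CompleteSpace H]

/-- A projection-valued measure on the Borel sets of `ℝ`, with values in the orthogonal
projections of `H`, countably additive in the strong operator topology. (The values on
non-measurable sets are never used.) -/
structure ProjectionValuedMeasure (H : Type*) [NormedAddCommGroup H] [InnerProductSpace ℂ H]
    [CompleteSpace H] where
  proj : Set ℝ → H →L[ℂ] H
  isStarProjection : ∀ B, MeasurableSet B → IsStarProjection (proj B)
  proj_univ : proj Set.univ = 1
  proj_inter : ∀ B B', MeasurableSet B → MeasurableSet B' → proj (B ∩ B') = proj B * proj B'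
  hasSum_iUnion : ∀ B : ℕ → Set ℝ, (∀ n, MeasurableSet (B n)) →
    Pairwise (fun m n => Disjoint (B m) (B n)) →
    ∀ x, HasSum (fun n => proj (B n) x) (proj (⋃ n, B n) x)

namespace ProjectionValuedMeasure

theorem inner_nonneg (P : ProjectionValuedMeasure H) (x : H) {B : Set ℝ}
    (hB : MeasurableSet B) : 0 ≤ (⟪x, P.proj B x⟫_ℂ).re := by
  have h := P.isStarProjection B hB
  have h1 : P.proj B (P.proj B x) = P.proj B x :=
    congrArg (fun T : H →L[ℂ] H => T x) h.isIdempotentElem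
  have h2 := (ContinuousLinearMap.isSelfAdjoint_iff_isSymmetric.mp h.isSelfAdjoint) x
    (P.proj B x)
  have h3 : ⟪x, P.proj B x⟫_ℂ = ⟪P.proj B x, P.proj B x⟫_ℂ := by
    rw [← h1]
    simpa [h1] using h2.symm
  rw [h3]
  exact inner_self_nonneg (𝕜 := ℂ) (x := P.proj B x)

theorem proj_empty (P : ProjectionValuedMeasure H) : P.proj ∅ = 0 := by
  ext x
  have h := P.hasSum_iUnion (fun _ => ∅) (fun _ => MeasurableSet.empty)
    (fun _ _ _ => disjoint_bot_left) x
  exact tendsto_nhds_unique tendsto_const_nhds h.summable.tendsto_atTop_zero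

/-- The finite positive scalar measure `μ_x(B) = ⟨x, P(B) x⟩`. -/
def scalarMeasure (P : ProjectionValuedMeasure H) (x : H) : Measure ℝ :=
  Measure.ofMeasurable (fun B _ => ENNReal.ofReal (⟪x, P.proj B x⟫_ℂ).re)
    (by simp [P.proj_empty])
    (by
      intro B hB hd
      have h := P.hasSum_iUnion B hB hd x
      have h2 : HasSum (fun n => (⟪x, P.proj (B n) x⟫_ℂ).re)
          (⟪x, P.proj (⋃ n, B n) x⟫_ℂ).re :=
        Complex.hasSum_re (h.mapL (innerSL ℂ x))
      rw [← h2.tsum_eq]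
      exact ENNReal.ofReal_tsum_of_nonneg (fun n => P.inner_nonneg x (hB n)) h2.summable)

/-- `P` is the spectral measure of the (possibly unbounded) operator `D`, that is,
`D = ∫ t dP(t)`: the domain of `D` consists of the `x` with `∫ t² dμ_x(t) < ∞`, and
`⟨x, D x⟩ = ∫ t dμ_x(t)` on it (which determines `D x`, by polarization and density).
By the spectral theorem every self-adjoint `D` has exactly one spectral measure. -/
def IsSpectralMeasureOf (P : ProjectionValuedMeasure H) (D : H →ₗ.[ℂ] H) : Prop :=
  (∀ x, x ∈ D.domain ↔ ∫⁻ t, ENNReal.ofReal (t ^ 2) ∂(P.scalarMeasure x) < ∞) ∧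
  ∀ x : D.domain, ⟪(x : H), D x⟫_ℂ = ((∫ t, t ∂(P.scalarMeasure (x : H)) : ℝ) : ℂ)

/-- The bounded operator `A` is the integral `∫ f dP`, in the weak sense
`⟨x, A x⟩ = ∫ f dμ_x` for all `x` (which determines `A` by polarization). -/
def IsIntegral (P : ProjectionValuedMeasure H) (f : ℝ → ℝ) (A : H →L[ℂ] H) : Prop :=
  ∀ x, Integrable f (P.scalarMeasure x) ∧
    ⟪x, A x⟫_ℂ = ((∫ t, f t ∂(P.scalarMeasure x) : ℝ) : ℂ)

end ProjectionValuedMeasure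

/-- A bounded operator as an everywhere defined partial operator. -/
def boundedPMap (X : H →L[ℂ] H) : H →ₗ.[ℂ] H := (X : H →ₗ[ℂ] H).toPMap ⊤

/-- `A = f(D)` in the sense of the Borel functional calculus of `D`. -/
def IsBorelTransform (D : H →ₗ.[ℂ] H) (f : ℝ → ℝ) (A : H →L[ℂ] H) : Prop :=
  ∃ P : ProjectionValuedMeasure H, P.IsSpectralMeasureOf D ∧ P.IsIntegral f A

/-- Bounded Borel functions on the real line. -/
def IsBoundedBorel (f : ℝ → ℝ) : Prop :=
  Measurable f ∧ ∃ M : ℝ, ∀ t, |f t| ≤ M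

variable (H) in
/-- Index set of a fixed orthonormal basis of `H`. -/
def basisIndex : Set H := (exists_hilbertBasis ℂ H).choose

variable (H) in
/-- A fixed orthonormal basis of `H`; neither the trace class nor the trace depends on it. -/
def fixedBasis : HilbertBasis (basisIndex H) ℂ H := (exists_hilbertBasis ℂ H).choose_spec.choose

/-- `T` is trace class: `∑ ⟨e, |T| e⟩ < ∞`. -/
def IsTraceClass (T : H →L[ℂ] H) : Prop :=
  Summable fun i => (⟪fixedBasis H i, CFC.abs T (fixedBasis H i)⟫_ℂ).re

/-- The trace `∑ ⟨e, T e⟩` of a trace-class operator. -/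
def opTrace (T : H →L[ℂ] H) : ℂ := ∑' i, ⟪fixedBasis H i, T (fixedBasis H i)⟫_ℂ

/-- `X` acts on the subspace `K`: it maps into `K` and vanishes on the complement of `K`. -/
def ActsOn (X : H →L[ℂ] H) (K : Submodule ℂ H) : Prop :=
  (∀ x, X x ∈ K) ∧ ∀ x ∈ Kᗮ, X x = 0

/-- `X` and `Y` act on orthogonal subspaces; then `X ⊕ Y`, as an operator on `H`, is `X + Y`. -/
def ActOnOrthogonal (X Y : H →L[ℂ] H) : Prop :=
  ∃ K L : Submodule ℂ H, K ⟂ L ∧ ActsOn X K ∧ ActsOn Y L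

/-- Convergence in the strong operator topology. -/
def StrongLim (X : ℕ → H →L[ℂ] H) (X₀ : H →L[ℂ] H) : Prop :=
  ∀ x, Tendsto (fun n => X n x) atTop (𝓝 (X₀ x))

/-- A stable class of bounded self-adjoint operators: closed under real bounded Borel functional
calculus, orthogonal sums, and strong limits of monotone sequences. -/
structure IsStableClass (C : Set (H →L[ℂ] H)) : Prop where
  isSelfAdjoint : ∀ X ∈ C, IsSelfAdjoint X
  borel : ∀ X ∈ C, ∀ f : ℝ → ℝ, IsBoundedBorel f →
    ∀ A, IsBorelTransform (boundedPMap X) f A → A ∈ C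
  orthogonalSum : ∀ X ∈ C, ∀ Y ∈ C, ActOnOrthogonal X Y → X + Y ∈ C
  monotoneLimit : ∀ (X : ℕ → H →L[ℂ] H) (X₀ : H →L[ℂ] H), (∀ n, X n ∈ C) →
    (Monotone X ∨ Antitone X) → StrongLim X X₀ → X₀ ∈ C

/-- An evaluator `E : C → [0, ∞]` on a class `C` of bounded self-adjoint operators. Only the
values of `E` on `C` matter. -/
structure IsEvaluator (C : Set (H →L[ℂ] H)) (E : (H →L[ℂ] H) → ℝ≥0∞) : Prop where
  /-- Unitary invariance; `U* X U` has to be in the domain `C` of `E`. -/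
  unitary : ∀ U ∈ unitary (H →L[ℂ] H), ∀ X ∈ C,
    star U * X * U ∈ C ∧ E (star U * X * U) = E X
  /-- Extensivity on orthogonal sums. -/
  extensive : ∀ X ∈ C, ∀ Y ∈ C, ActOnOrthogonal X Y → X + Y ∈ C → E (X + Y) = E X + E Y
  /-- Projector-locality. -/
  projectorLocal : ∀ (m : ℕ) (l : Fin m → ℝ) (P : Fin m → H →L[ℂ] H),
    Function.Injective l → (∀ j, IsStarProjection (P j)) →
    (∀ i j, i ≠ j → P i * P j = 0) →
    (∑ j, (l j : ℂ) • P j) ∈ C → (∀ j, (l j : ℂ) • P j ∈ C) →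
    E (∑ j, (l j : ℂ) • P j) = ∑ j, E ((l j : ℂ) • P j)
  /-- Dominated continuity in the strong operator topology. -/
  dominated : ∀ (X : ℕ → H →L[ℂ] H) (X₀ Y : H →L[ℂ] H), (∀ n, X n ∈ C) → X₀ ∈ C → Y ∈ C →
    (∀ n, 0 ≤ X n) → 0 ≤ X₀ → (∀ n, X n ≤ Y) → StrongLim X X₀ → E Y < ∞ →
    Tendsto (fun n => E (X n)) atTop (𝓝 (E X₀))
  /-- Normalization. -/
  one_mem : (1 : H →L[ℂ] H) ∈ C
  one_pos : 0 < E 1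
  one_lt_top : E 1 < ∞
  scalar : ∀ t : ℝ, 0 ≤ t → (t : ℂ) • (1 : H →L[ℂ] H) ∈ C ∧
    E ((t : ℂ) • (1 : H →L[ℂ] H)) = ENNReal.ofReal t * E 1

/-- The value of an evaluator on a signed self-adjoint operator, `E(X₊) - E(X₋)`. It equals a
real number only if both terms are finite. For `X ≥ 0` it is `E(X)`. -/
def signedValue (E : (H →L[ℂ] H) → ℝ≥0∞) (X : H →L[ℂ] H) : EReal :=
  (E X⁺ : EReal) - (E X⁻ : EReal)

/-- The extended number `v` equals `c · Tr(h(X))`, where `h(X)` is a trace-class operator. (The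
trace of the self-adjoint operator `h(X)` is real.) -/
def EqTraceForm (v : EReal) (c : ℝ) (h : ℝ → ℝ) (X : H →L[ℂ] H) : Prop :=
  ∃ A : H →L[ℂ] H, IsBorelTransform (boundedPMap X) h A ∧ IsTraceClass A ∧
    v = ((c * (opTrace A).re : ℝ) : EReal)

end

/-! The axioms are rigid enough that `h` is the identity: on trace-class elements of the class `E`
is a constant times the trace, and in infinite dimensions the only such element is `0`.

A trace-class element is compact and self-adjoint, so `X = b.diag l` in some Hilbert basis, and
everything reduces to real families on an index set. Indicators of level sets of `l` give spectral
projections in `C`; permutations of the index set act as unitaries, so a diagonal projection of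
finite rank has all its equal-rank copies in `C`, with the same value.

In infinite dimensions (`not_mem_of_infinite`), a nonzero finite-rank projection `P` in `C` has
arbitrarily many orthogonal copies below `1`, so `n * E P ≤ E 1 < ∞` for all `n`, and `E P = 0`.
Sums of copies increase strongly to `1`, so dominated continuity gives `E 1 = 0`, a contradiction. A
nonzero trace-class element would have such a spectral projection.

In dimension `N` (`card_mul_diag`, `card_mul_diag_of_nonneg`), a Euclidean algorithm on ranks shows
that `E (μP)` is proportional to the rank of `P`. Comparison with `E (μ1) = μ * E 1` and summation
over level sets give `E X = (E 1 / N) * Tr X` for `X ≥ 0`.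

For uniqueness, the formula on `t • 1` forces `c' * h' t = c * t`. -/

/-- Bounded real families. -/
def BoundedFamily {ι : Type*} (f : ι → ℝ) : Prop := ∃ M : ℝ, ∀ i, |f i| ≤ M

namespace BoundedFamily

variable {ι : Type*} {f g : ι → ℝ}

theorem const (c : ℝ) : BoundedFamily (fun _ : ι => c) := ⟨|c|, fun _ => le_rfl⟩

theorem add (hf : BoundedFamily f) (hg : BoundedFamily g) : BoundedFamily (fun i => f i + g i) := by
  obtain ⟨M, hM⟩ := hf
  obtain ⟨N, hN⟩ := hg
  exact ⟨M + N, fun i => (abs_add_le _ _).trans (add_le_add (hM i) (hN i))⟩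

theorem mul (hf : BoundedFamily f) (hg : BoundedFamily g) : BoundedFamily (fun i => f i * g i) := by
  obtain ⟨M, hM⟩ := hf
  obtain ⟨N, hN⟩ := hg
  refine ⟨M * N, fun i => ?_⟩
  rw [abs_mul]
  exact mul_le_mul (hM i) (hN i) (abs_nonneg _) ((abs_nonneg _).trans (hM i))

theorem mono (hf : BoundedFamily f) (h : ∀ i, |g i| ≤ |f i|) : BoundedFamily g := by
  obtain ⟨M, hM⟩ := hf
  exact ⟨M, fun i => (h i).trans (hM i)⟩

theorem comp {κ : Type*} (hf : BoundedFamily f) (σ : κ → ι) : BoundedFamily (f ∘ σ) := by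
  obtain ⟨M, hM⟩ := hf
  exact ⟨M, fun i => hM (σ i)⟩

theorem indicator (s : Set ι) (c : ℝ) : BoundedFamily (s.indicator (fun _ => c)) := by
  refine (const (ι := ι) c).mono fun i => ?_
  by_cases h : i ∈ s <;> simp [h]

theorem of_finite [Finite ι] (f : ι → ℝ) : BoundedFamily f := by
  obtain ⟨M, hM⟩ := (Set.finite_range (fun i => |f i|)).bddAbove
  exact ⟨M, fun i => hM ⟨i, rfl⟩⟩

end BoundedFamily

/-! ### Diagonal operators in a Hilbert basis -/

noncomputable section

variable {H : Type*} [NormedAddCommGroup H] [InnerProductSpace ℂ H] {ι : Type*}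

namespace HilbertBasis

theorem hasSum_norm_sq_repr (b : HilbertBasis ι ℂ H) (x : H) :
    HasSum (fun i => ‖b.repr x i‖ ^ 2) (‖x‖ ^ 2) := by
  have h := Complex.hasSum_re (b.hasSum_inner_mul_inner x x)
  have e : (⟪x, x⟫_ℂ).re = ‖x‖ ^ 2 := by
    simpa using (inner_self_eq_norm_sq (𝕜 := ℂ) x)
  rw [e] at h
  convert h using 2 with i
  rw [b.repr_apply_apply, ← inner_conj_symm x (b i), ← Complex.normSq_eq_norm_sq,
    Complex.normSq_eq_conj_mul_self.symm]
  simp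

theorem repr_ext (b : HilbertBasis ι ℂ H) {x y : H} (h : ∀ i, b.repr x i = b.repr y i) :
    x = y :=
  b.repr.injective (lp.ext (funext h))

theorem memℓp_mul_repr (b : HilbertBasis ι ℂ H) {f : ι → ℝ} {M : ℝ} (hM : ∀ i, |f i| ≤ M) (x : H) :
    Memℓp (fun i => (f i : ℂ) * b.repr x i) 2 := by
  refine memℓp_gen ?_
  have h := (b.hasSum_norm_sq_repr x).summable.mul_left (M ^ 2)
  refine Summable.of_nonneg_of_le (fun i => by positivity) (fun i => ?_) h
  have h1 : |f i| ^ 2 ≤ M ^ 2 := pow_le_pow_left₀ (abs_nonneg _) (hM i) 2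
  simpa [mul_pow] using mul_le_mul_of_nonneg_right h1 (sq_nonneg ‖b.repr x i‖)

/-- The operator multiplying the coordinates in the Hilbert basis `b` by a bounded family. -/
def diag (b : HilbertBasis ι ℂ H) (f : ι → ℝ) : H →L[ℂ] H :=
  open Classical in
  -- An unbounded family gives the operator `0`, so self-adjointness and positivity below need no
  -- boundedness hypothesis.
  if hf : BoundedFamily f then
    LinearMap.mkContinuous
      { toFun := fun x => b.repr.symm ⟨fun i => (f i : ℂ) * b.repr x i,
          b.memℓp_mul_repr hf.choose_spec x⟩
        map_add' := fun x y => b.repr_ext fun i => by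
          simp only [map_add, lp.coeFn_add, Pi.add_apply, LinearIsometryEquiv.apply_symm_apply]
          exact mul_add _ _ _
        map_smul' := fun c x => b.repr_ext fun i => by
          simp; ring }
      |hf.choose| (fun x => by
        refine abs_le_of_sq_le_sq' ?_ (by positivity) |>.2
        rw [mul_pow, sq_abs]
        refine hasSum_le (fun i => ?_) (b.hasSum_norm_sq_repr _)
          ((b.hasSum_norm_sq_repr x).mul_left (hf.choose ^ 2))
        have h1 : |f i| ^ 2 ≤ hf.choose ^ 2 :=
          pow_le_pow_left₀ (abs_nonneg _) (hf.choose_spec i) 2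
        simpa [mul_pow] using mul_le_mul_of_nonneg_right h1 (sq_nonneg ‖b.repr x i‖))
  else 0

variable (b : HilbertBasis ι ℂ H) {f g : ι → ℝ}

theorem repr_diag (hf : BoundedFamily f) (x : H) (i : ι) :
    b.repr (b.diag f x) i = f i * b.repr x i := by
  simp [diag, hf]

theorem hasSum_norm_sq_diag (hf : BoundedFamily f) (x : H) :
    HasSum (fun i => f i ^ 2 * ‖b.repr x i‖ ^ 2) (‖b.diag f x‖ ^ 2) := by
  simpa [b.repr_diag hf, mul_pow] using b.hasSum_norm_sq_repr (b.diag f x)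

theorem hasSum_inner_diag (hf : BoundedFamily f) (x : H) :
    HasSum (fun i => f i * ‖b.repr x i‖ ^ 2) (⟪x, b.diag f x⟫_ℂ).re := by
  have h := Complex.hasSum_re (b.hasSum_inner_mul_inner x (b.diag f x))
  convert h using 2 with i
  rw [← b.repr_apply_apply (b.diag f x), b.repr_diag hf, ← inner_conj_symm x (b i),
    b.repr_apply_apply, ← Complex.normSq_eq_norm_sq, mul_left_comm, ← Complex.normSq_eq_conj_mul_self]
  simp

theorem diag_apply_basis (hf : BoundedFamily f) (i : ι) : b.diag f (b i) = (f i : ℂ) • b i := by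
  classical
  refine b.repr_ext fun j => ?_
  rw [b.repr_diag hf, map_smul, b.repr_self, lp.coeFn_smul, Pi.smul_apply, smul_eq_mul]
  by_cases h : j = i
  · rw [h]
  · simp [h]

theorem eq_diag (hf : BoundedFamily f) (T : H →L[ℂ] H)
    (h : ∀ x i, b.repr (T x) i = f i * b.repr x i) : T = b.diag f :=
  ContinuousLinearMap.ext fun x => b.repr_ext fun i => by rw [h, b.repr_diag hf]

theorem diag_add (hf : BoundedFamily f) (hg : BoundedFamily g) :
    b.diag f + b.diag g = b.diag (fun i => f i + g i) :=
  b.eq_diag (hf.add hg) _ fun x i => by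
    simp [b.repr_diag hf, b.repr_diag hg, add_mul]

theorem diag_mul (hf : BoundedFamily f) (hg : BoundedFamily g) :
    b.diag f * b.diag g = b.diag (fun i => f i * g i) :=
  b.eq_diag (hf.mul hg) _ fun x i => by
    simp [b.repr_diag hf, b.repr_diag hg, mul_assoc]

theorem diag_const (c : ℝ) : b.diag (fun _ => c) = (c : ℂ) • (1 : H →L[ℂ] H) :=
  (b.eq_diag (.const c) _ fun x i => by
    rw [smul_apply, map_smul]; rfl).symm

theorem diag_zero : b.diag (fun _ => 0) = 0 := by simp [b.diag_const]

theorem diag_one : b.diag (fun _ => 1) = 1 := by simp [b.diag_const]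

theorem diag_sub (hf : BoundedFamily f) (hg : BoundedFamily g) :
    b.diag f - b.diag g = b.diag (fun i => f i - g i) := by
  have h : BoundedFamily (fun i => f i - g i) := by
    have := hf.add (hg.mul (.const (-1)))
    simpa [sub_eq_add_neg] using this
  exact b.eq_diag h _ fun x i => by simp [b.repr_diag hf, b.repr_diag hg, sub_mul]

theorem diag_finsetSum {κ : Type*} (F : Finset κ) (f : κ → ι → ℝ)
    (hf : ∀ k ∈ F, BoundedFamily (f k)) :
    BoundedFamily (fun i => ∑ k ∈ F, f k i) ∧
      ∑ k ∈ F, b.diag (f k) = b.diag (fun i => ∑ k ∈ F, f k i) := by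
  classical
  induction F using Finset.induction_on with
  | empty => exact ⟨by simpa using BoundedFamily.const 0, by simp [b.diag_zero]⟩
  | insert k F hk ih =>
    obtain ⟨h1, h2⟩ := ih fun j hj => hf j (Finset.mem_insert_of_mem hj)
    have h3 := hf k (Finset.mem_insert_self k F)
    simp only [Finset.sum_insert hk]
    exact ⟨h3.add h1, by rw [h2, b.diag_add h3 h1]⟩

/-- Diagonal operators converge strongly if their coefficients converge pointwise and boundedly. -/
theorem tendsto_diag {κ : Type*} {l : Filter κ} {F : κ → ι → ℝ} {M : ℝ}
    (hF : ∀ k i, |F k i| ≤ M) (hf : ∀ i, |f i| ≤ M)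
    (hlim : ∀ i, Tendsto (fun k => F k i) l (𝓝 (f i))) (x : H) :
    Tendsto (fun k => b.diag (F k) x) l (𝓝 (b.diag f x)) := by
  rw [tendsto_iff_norm_sub_tendsto_zero]
  have hb : ∀ k, BoundedFamily (fun i => F k i - f i) := fun k =>
    ⟨M + M, fun i => (abs_sub _ _).trans (add_le_add (hF k i) (hf i))⟩
  have h1 : ∀ k, ‖b.diag (F k) x - b.diag f x‖ ^ 2 =
      ∑' i, (F k i - f i) ^ 2 * ‖b.repr x i‖ ^ 2 := fun k => by
    rw [(b.hasSum_norm_sq_diag (hb k) x).tsum_eq, ← b.diag_sub ⟨M, hF k⟩ ⟨M, hf⟩]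
    rfl
  have h2 : Tendsto (fun k => ‖b.diag (F k) x - b.diag f x‖ ^ 2) l (𝓝 0) := by
    simp only [h1]
    have h3 : (0 : ℝ) = ∑' i : ι, (0 : ℝ) := by simp
    rw [h3]
    refine tendsto_tsum_of_dominated_convergence
      (bound := fun i => (M + M) ^ 2 * ‖b.repr x i‖ ^ 2)
      ((b.hasSum_norm_sq_repr x).summable.mul_left _) (fun i => ?_) (.of_forall fun k i => ?_)
    · have := (((hlim i).sub_const (f i)).pow 2).mul_const (‖b.repr x i‖ ^ 2)
      simpa using this
    · rw [Real.norm_of_nonneg (by positivity), ← sq_abs (F k i - f i)]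
      gcongr
      exact (abs_sub _ _).trans (add_le_add (hF k i) (hf i))
  have h4 := h2.sqrt
  simpa using h4

variable [CompleteSpace H]

theorem diag_isSelfAdjoint (f : ι → ℝ) : IsSelfAdjoint (b.diag f) := by
  by_cases hf : BoundedFamily f
  · rw [ContinuousLinearMap.isSelfAdjoint_iff_isSymmetric]
    intro x y
    change ⟪b.diag f x, y⟫_ℂ = ⟪x, b.diag f y⟫_ℂ
    have h1 := b.hasSum_inner_mul_inner (b.diag f x) y
    have h2 := b.hasSum_inner_mul_inner x (b.diag f y)
    refine h1.unique ?_
    convert h2 using 2 with i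
    rw [← inner_conj_symm _ (b i), ← inner_conj_symm x (b i)]
    simp only [← b.repr_apply_apply, b.repr_diag hf]
    simp
    ring
  · simp [diag, hf]

theorem diag_nonneg (hf : ∀ i, 0 ≤ f i) : 0 ≤ b.diag f := by
  by_cases hb : BoundedFamily f
  · rw [ContinuousLinearMap.nonneg_iff_isPositive, ContinuousLinearMap.isPositive_def']
    refine ⟨b.diag_isSelfAdjoint f, fun x => ?_⟩
    have h := (b.hasSum_inner_diag hb x).nonneg fun i => by have := hf i; positivity
    rw [ContinuousLinearMap.reApplyInnerSelf_apply, ← inner_conj_symm]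
    simpa [-inner_conj_symm] using h
  · simp [diag, hb]

theorem diag_mono (hf : BoundedFamily f) (hg : BoundedFamily g) (h : ∀ i, f i ≤ g i) :
    b.diag f ≤ b.diag g := by
  rw [← sub_nonneg, b.diag_sub hg hf]
  exact b.diag_nonneg fun i => sub_nonneg.2 (h i)

theorem isStarProjection_diag_indicator (s : Set ι) :
    IsStarProjection (b.diag (s.indicator fun _ => 1)) := by
  refine ⟨?_, b.diag_isSelfAdjoint _⟩
  rw [IsIdempotentElem, b.diag_mul (.indicator s 1) (.indicator s 1)]
  congr 1
  ext i
  by_cases h : i ∈ s <;> simp [h]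

end HilbertBasis
end

/-! ### Spectral measure and Borel calculus of diagonal operators -/

noncomputable section

variable {H : Type*} [NormedAddCommGroup H] [InnerProductSpace ℂ H] [CompleteSpace H]
  {ι : Type*}

theorem IsSelfAdjoint.inner_eq_ofReal_re {A : H →L[ℂ] H} (hA : IsSelfAdjoint A) (x : H) :
    ⟪x, A x⟫_ℂ = ((⟪x, A x⟫_ℂ).re : ℂ) := by
  have h := ContinuousLinearMap.isSelfAdjoint_iff_isSymmetric.mp hA x x
  change ⟪A x, x⟫_ℂ = ⟪x, A x⟫_ℂ at h
  rw [eq_comm, Complex.conj_eq_iff_re.symm, inner_conj_symm, h]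

namespace HilbertBasis

/-- The spectral measure of the diagonal operator with eigenvalues `l`. -/
def spectralMeasure (b : HilbertBasis ι ℂ H) (l : ι → ℝ) : ProjectionValuedMeasure H where
  proj B := b.diag ((l ⁻¹' B).indicator fun _ => 1)
  isStarProjection B _ := b.isStarProjection_diag_indicator _
  proj_univ := by simp [← b.diag_one]
  proj_inter B B' _ _ := by
    rw [b.diag_mul (.indicator _ 1) (.indicator _ 1), Set.preimage_inter]
    congr 1
    ext i
    by_cases h : i ∈ l ⁻¹' B <;> by_cases h' : i ∈ l ⁻¹' B' <;> simp_all
  hasSum_iUnion B _ hd x := by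
    have hbd : ∀ (s : Set ι) (i : ι), |s.indicator (fun _ => (1 : ℝ)) i| ≤ 1 := fun s i => by
      by_cases h : i ∈ s <;> simp [h]
    have hF : ∀ (F : Finset ℕ) (i : ι),
        ∑ n ∈ F, (l ⁻¹' B n).indicator (fun _ => (1 : ℝ)) i =
          (l ⁻¹' ⋃ n ∈ F, B n).indicator (fun _ => 1) i := fun F i => by
      have := congrFun (Finset.indicator_biUnion F (fun n => l ⁻¹' B n) (f := fun _ : ι => (1 : ℝ))
        fun m _ n _ hmn => (hd hmn).preimage l) i
      simp only [Set.preimage_iUnion]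
      rw [this]
    have hsum : ∀ F : Finset ℕ, ∑ n ∈ F, b.diag ((l ⁻¹' B n).indicator fun _ => 1) x =
        b.diag ((l ⁻¹' ⋃ n ∈ F, B n).indicator fun _ => 1) x := fun F => by
      rw [← sum_apply, (b.diag_finsetSum F _ fun _ _ => .indicator _ 1).2]
      congr 2
      ext i
      exact hF F i
    rw [HasSum]
    simp only [hsum]
    refine b.tendsto_diag (M := 1) (fun _ _ => hbd _ _) (hbd _) (fun i => ?_) x
    -- In each coordinate the partial sums are eventually constant: `l i` lies in some `B n`, or in
    -- none.
    by_cases h : ∃ n, l i ∈ B n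
    · obtain ⟨n, hn⟩ := h
      refine tendsto_const_nhds.congr' ?_
      filter_upwards [Filter.Ici_mem_atTop ({n} : Finset ℕ)] with F hF
      have hnF : n ∈ F := hF (Finset.mem_singleton_self n)
      rw [Set.indicator_of_mem (by simpa using ⟨n, hn⟩),
        Set.indicator_of_mem (by simpa using ⟨n, hnF, hn⟩)]
    · push Not at h
      have h1 : ∀ F : Finset ℕ, i ∉ l ⁻¹' ⋃ n ∈ F, B n := fun F => by
        simp [h]
      have h2 : i ∉ l ⁻¹' ⋃ n, B n := by simp [h]
      simp only [Set.indicator_of_notMem (h1 _), Set.indicator_of_notMem h2]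
      exact tendsto_const_nhds

variable (b : HilbertBasis ι ℂ H) {l : ι → ℝ}

theorem scalarMeasure_spectralMeasure (l : ι → ℝ) (x : H) :
    (b.spectralMeasure l).scalarMeasure x =
      Measure.sum fun i => ENNReal.ofReal (‖b.repr x i‖ ^ 2) • Measure.dirac (l i) := by
  ext B hB
  rw [ProjectionValuedMeasure.scalarMeasure, Measure.ofMeasurable_apply B hB,
    Measure.sum_apply _ hB]
  have h := b.hasSum_inner_diag (.indicator (l ⁻¹' B) 1) x
  change ENNReal.ofReal (⟪x, b.diag ((l ⁻¹' B).indicator fun _ => 1) x⟫_ℂ).re = _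
  rw [← h.tsum_eq, ENNReal.ofReal_tsum_of_nonneg (fun i => ?_) h.summable]
  · refine tsum_congr fun i => ?_
    by_cases hi : l i ∈ B
    · simp [hi]
    · simp [hi]
  · have : (0 : ℝ) ≤ (l ⁻¹' B).indicator (fun _ => 1) i := Set.indicator_nonneg (by simp) i
    positivity

variable [Countable ι]

theorem isIntegral_spectralMeasure {g : ℝ → ℝ} (hg : BoundedFamily (g ∘ l)) :
    (b.spectralMeasure l).IsIntegral g (b.diag (g ∘ l)) := by
  intro x
  have h := b.hasSum_inner_diag hg x
  have hc : ∀ i, ENNReal.ofReal (‖b.repr x i‖ ^ 2) ≠ ∞ := fun i => ENNReal.ofReal_ne_top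
  have hs : Summable fun i => (ENNReal.ofReal (‖b.repr x i‖ ^ 2)).toReal * ‖g (l i)‖ := by
    obtain ⟨M, hM⟩ := hg
    refine Summable.of_nonneg_of_le (fun i => by positivity) (fun i => ?_)
      ((b.hasSum_norm_sq_repr x).summable.mul_right M)
    rw [ENNReal.toReal_ofReal (by positivity)]
    exact mul_le_mul_of_nonneg_left (hM i) (by positivity)
  rw [scalarMeasure_spectralMeasure]
  refine ⟨integrable_sum_dirac hc hs, ?_⟩
  rw [integral_sum_dirac_eq_tsum hc hs, (b.diag_isSelfAdjoint _).inner_eq_ofReal_re, ← h.tsum_eq]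
  congr 1
  refine tsum_congr fun i => ?_
  rw [ENNReal.toReal_ofReal (by positivity), smul_eq_mul, mul_comm]
  rfl

theorem isSpectralMeasureOf_diag (hl : BoundedFamily l) :
    (b.spectralMeasure l).IsSpectralMeasureOf (boundedPMap (b.diag l)) := by
  refine ⟨fun x => ⟨fun _ => ?_, fun _ => Submodule.mem_top⟩, fun x => ?_⟩
  · have h := (b.isIntegral_spectralMeasure (l := l) (g := fun t => t ^ 2) ?_ x).1
    · rw [← ofReal_integral_eq_lintegral_ofReal h (.of_forall fun t => sq_nonneg t)]
      exact ENNReal.ofReal_lt_top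
    · simpa only [Function.comp_def, pow_two] using hl.mul hl
  · exact (b.isIntegral_spectralMeasure (l := l) (g := fun t => t) hl x).2

/-- `IsBorelTransform` asks only for some spectral measure, so the atomic one suffices and
uniqueness of spectral measures plays no role here. -/
theorem isBorelTransform_diag (hl : BoundedFamily l) {g : ℝ → ℝ} (hg : BoundedFamily (g ∘ l)) :
    IsBorelTransform (boundedPMap (b.diag l)) g (b.diag (g ∘ l)) :=
  ⟨b.spectralMeasure l, b.isSpectralMeasureOf_diag hl, b.isIntegral_spectralMeasure hg⟩

end HilbertBasis

/-! ### Permutation unitaries and orthogonal ranges -/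

namespace HilbertBasis

variable (b : HilbertBasis ι ℂ H)

/-- The Hilbert basis reindexed by a permutation. -/
def permute (σ : Equiv.Perm ι) : HilbertBasis ι ℂ H :=
  HilbertBasis.mk (b.orthonormal.comp σ σ.injective) (by
    rw [Set.range_comp, σ.surjective.range_eq, Set.image_univ, b.dense_span])

theorem repr_permute (σ : Equiv.Perm ι) (x : H) (i : ι) :
    (b.permute σ).repr x i = b.repr x (σ i) := by
  rw [HilbertBasis.repr_apply_apply, HilbertBasis.repr_apply_apply, permute, HilbertBasis.coe_mk]
  rfl

/-- The unitary moves coordinate `i` to place `σ i`; there `b.diag f` multiplies it by `f (σ i)`,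
and the adjoint moves it back. -/
theorem exists_unitary_diag_comp (σ : Equiv.Perm ι) :
    ∃ U ∈ unitary (H →L[ℂ] H), ∀ f, BoundedFamily f →
      star U * b.diag f * U = b.diag (f ∘ σ) := by
  let V : H ≃ₗᵢ[ℂ] H := b.repr.trans (b.permute σ).repr.symm
  have hV : ∀ x i, b.repr (V x) (σ i) = b.repr x i := fun x i => by
    rw [← repr_permute]; simp [V]
  have hV' : ∀ x i, b.repr (V.symm x) i = b.repr x (σ i) := fun x i => by
    rw [← repr_permute]; simp [V]
  refine ⟨Unitary.linearIsometryEquiv.symm V, (Unitary.linearIsometryEquiv.symm V).2,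
    fun f hf => b.eq_diag (hf.comp σ) _ fun x i => ?_⟩
  have h : (star (Unitary.linearIsometryEquiv.symm V : H →L[ℂ] H)) =
      (V.symm.toContinuousLinearEquiv : H →L[ℂ] H) := by
    rw [← Unitary.coe_star, Unitary.star_eq_inv, ← map_inv]
    rfl
  rw [h]
  change b.repr (V.symm (b.diag f (V x))) i = _
  rw [hV', b.repr_diag hf, hV]
  rfl

end HilbertBasis

/-- The subspaces are the two ranges: `⟪X x, Y y⟫ = ⟪x, X (Y y)⟫ = 0`, and a self-adjoint operator
vanishes on the complement of its range. -/
theorem actOnOrthogonal_of_mul_eq_zero {X Y : H →L[ℂ] H} (hX : IsSelfAdjoint X)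
    (hY : IsSelfAdjoint Y) (h : X * Y = 0) : ActOnOrthogonal X Y := by
  have hX' := ContinuousLinearMap.isSelfAdjoint_iff_isSymmetric.mp hX
  have hY' := ContinuousLinearMap.isSelfAdjoint_iff_isSymmetric.mp hY
  have key : ∀ T : H →L[ℂ] H, T.IsSymmetric → ActsOn T (LinearMap.range (T : H →ₗ[ℂ] H)) :=
    fun T hT => ⟨fun x => ⟨x, rfl⟩, fun x hx => by
      rw [← inner_self_eq_zero (𝕜 := ℂ)]
      have h1 : ⟪T (T x), x⟫_ℂ = 0 := hx _ ⟨T x, rfl⟩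
      rw [← h1]
      exact (hT (T x) x).symm⟩
  refine ⟨_, _, ?_, key X hX', key Y hY'⟩
  rw [Submodule.isOrtho_iff_inner_eq]
  rintro _ ⟨x, rfl⟩ _ ⟨y, rfl⟩
  have h1 : X (Y y) = 0 := congrArg (fun T : H →L[ℂ] H => T y) h
  refine (hX' x (Y y)).trans ?_
  change ⟪x, X (Y y)⟫_ℂ = 0
  rw [h1, inner_zero_right]

end

/-! ### Trace-class self-adjoint operators are diagonal -/

noncomputable section

variable {H : Type*} [NormedAddCommGroup H] [InnerProductSpace ℂ H] {ι : Type*}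

namespace HilbertBasis

theorem isCompactOperator_diag_indicator_finset (b : HilbertBasis ι ℂ H) (F : Finset ι) :
    IsCompactOperator (b.diag ((F : Set ι).indicator fun _ => 1)) := by
  classical
  have h1 : ∀ i, IsCompactOperator (b.diag (({i} : Set ι).indicator fun _ => 1)) := fun i => by
    have h : b.diag (({i} : Set ι).indicator fun _ => 1) =
        (ContinuousLinearMap.toSpanSingleton ℂ (b i)).comp (innerSL ℂ (b i)) := by
      refine (b.eq_diag (.indicator _ 1) _ fun x j => ?_).symm
      have e : ((ContinuousLinearMap.toSpanSingleton ℂ (b i)).comp (innerSL ℂ (b i))) x =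
          ⟪b i, x⟫_ℂ • b i := rfl
      rw [e, map_smul, b.repr_self, lp.coeFn_smul, Pi.smul_apply, ← b.repr_apply_apply]
      by_cases hj : j = i
      · subst hj; simp
      · simp [hj]
    rw [h]
    exact (isCompactOperator_of_locallyCompactSpace_dom
      (innerSL ℂ (b i))).clm_comp (ContinuousLinearMap.toSpanSingleton ℂ (b i))
  have h2 : b.diag ((F : Set ι).indicator fun _ => 1) =
      ∑ i ∈ F, b.diag (({i} : Set ι).indicator fun _ => 1) := by
    rw [(b.diag_finsetSum F _ fun _ _ => .indicator _ 1).2]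
    congr 1
    ext j
    by_cases hj : j ∈ F <;> simp [Set.indicator_apply, hj]
  rw [h2]
  exact Submodule.sum_mem (compactOperator (RingHom.id ℂ) H H) fun i _ => h1 i

/-- Distinct basis vectors are at distance `√2`, so the balls of radius `1/2` about them are
disjoint. -/
theorem countable_index [TopologicalSpace.SeparableSpace H] (b : HilbertBasis ι ℂ H) :
    Countable ι := by
  refine Pairwise.countable_of_isOpen_disjoint (s := fun i => Metric.ball (b i) (1 / 2)) ?_
    (fun _ => Metric.isOpen_ball) (fun i => ⟨b i, Metric.mem_ball_self (by norm_num)⟩)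
  intro i j hij
  refine Metric.ball_disjoint_ball ?_
  have h1 : ‖b i - b j‖ ^ 2 = 2 := by
    have := norm_sub_sq (𝕜 := ℂ) (b i) (b j)
    rw [this, b.orthonormal.norm_eq_one, b.orthonormal.norm_eq_one,
      b.orthonormal.inner_eq_zero hij]
    norm_num
  rw [dist_eq_norm]
  nlinarith [norm_nonneg (b i - b j)]

variable (b : HilbertBasis ι ℂ H) {f : ι → ℝ}

/-- The trace of a positive diagonal operator can be computed in every Hilbert basis. -/
theorem tsum_inner_diag {κ : Type*} (e : HilbertBasis κ ℂ H) (hf : BoundedFamily f)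
    (h0 : ∀ i, 0 ≤ f i) :
    ∑' k, ENNReal.ofReal (⟪e k, b.diag f (e k)⟫_ℂ).re = ∑' i, ENNReal.ofReal (f i) := by
  have h1 : ∀ k, ENNReal.ofReal (⟪e k, b.diag f (e k)⟫_ℂ).re =
      ∑' i, ENNReal.ofReal (f i) * ENNReal.ofReal (‖b.repr (e k) i‖ ^ 2) := fun k => by
    have h := b.hasSum_inner_diag hf (e k)
    rw [← h.tsum_eq, ENNReal.ofReal_tsum_of_nonneg
      (fun i => mul_nonneg (h0 i) (by positivity)) h.summable]
    exact tsum_congr fun i => ENNReal.ofReal_mul (h0 i)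
  simp only [h1]
  -- Tonelli, followed by Parseval for `b i` in the basis `e`.
  rw [ENNReal.tsum_comm]
  refine tsum_congr fun i => ?_
  rw [ENNReal.tsum_mul_left]
  have h2 := e.hasSum_norm_sq_repr (b i)
  have h3 : ∑' k, ENNReal.ofReal (‖b.repr (e k) i‖ ^ 2) = 1 := by
    rw [b.orthonormal.norm_eq_one, one_pow] at h2
    rw [← ENNReal.ofReal_one, ← h2.tsum_eq,
      ENNReal.ofReal_tsum_of_nonneg (fun i => by positivity) h2.summable]
    refine tsum_congr fun k => ?_
    rw [b.repr_apply_apply, e.repr_apply_apply, norm_inner_symm]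
  rw [h3, mul_one]

end HilbertBasis

variable [CompleteSpace H]

/-- A self-adjoint trace-class operator is compact. -/
theorem IsTraceClass.isCompactOperator {X : H →L[ℂ] H} (hT : IsTraceClass X)
    (hX : IsSelfAdjoint X) : IsCompactOperator X := by
  -- Write `X = S A` with `S = |X|^{1/2}` and `A = sgn(X)|X|^{1/2}`. Then `∑ ‖S e_i‖² = Tr |X|` is
  -- finite, so `S` is Hilbert–Schmidt and its finite-rank truncations converge in norm.
  set S : H →L[ℂ] H := cfc (fun t : ℝ => √|t|) X with hS
  set A : H →L[ℂ] H := cfc (fun t : ℝ => √(max t 0) - √(max (-t) 0)) X with hA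
  have hSA : S * A = X := by
    rw [hS, hA, ← cfc_mul (fun t : ℝ => √|t|) (fun t : ℝ => √(max t 0) - √(max (-t) 0)) X
      (by fun_prop) (by fun_prop)]
    conv_rhs => rw [← cfc_id' ℝ X]
    congr 1
    ext t
    rcases le_total t 0 with ht | ht
    · simp [ht, abs_of_nonpos ht]
    · simp [ht, abs_of_nonneg ht]
  have hSS : S * S = CFC.abs X := by
    rw [hS, ← cfc_mul (fun t : ℝ => √|t|) (fun t : ℝ => √|t|) X, CFC.abs_eq_cfc_norm X]
    congr 1
    ext t
    simp
  have hSsa : IsSelfAdjoint S := IsSelfAdjoint.cfc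
  have hsymm : ∀ x y, ⟪S x, y⟫_ℂ = ⟪x, S y⟫_ℂ :=
    ContinuousLinearMap.isSelfAdjoint_iff_isSymmetric.mp hSsa
  have hsum : Summable fun i => ‖S (fixedBasis H i)‖ ^ 2 := by
    refine hT.congr fun i => ?_
    rw [← hSS]
    change (⟪_, S (S _)⟫_ℂ).re = _
    rw [← hsymm]
    exact inner_self_eq_norm_sq (𝕜 := ℂ) _
  set e := fixedBasis H
  set tail : Finset (basisIndex H) → ℝ := fun F =>
    ∑' i : {i // i ∉ F}, ‖S (e i)‖ ^ 2 with htail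
  have htail0 : Tendsto tail atTop (𝓝 0) :=
    tendsto_tsum_compl_atTop_zero fun i => ‖S (e i)‖ ^ 2
  have hb : ∀ F : Finset (basisIndex H), ∀ x,
      ‖S x - e.diag ((F : Set _).indicator fun _ => 1) (S x)‖ ^ 2 ≤ tail F * ‖x‖ ^ 2 := by
    intro F x
    have h1 : S x - e.diag ((F : Set _).indicator fun _ => 1) (S x) =
        e.diag (((F : Set _)ᶜ).indicator fun _ => 1) (S x) := by
      have : e.diag ((F : Set _).indicator fun _ => 1) +
          e.diag (((F : Set _)ᶜ).indicator fun _ => 1) = 1 := by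
        rw [e.diag_add (.indicator _ 1) (.indicator _ 1), ← e.diag_one]
        congr 1
        ext i
        by_cases hi : i ∈ F <;> simp [hi]
      rw [sub_eq_iff_eq_add']
      exact (congrArg (fun T : H →L[ℂ] H => T (S x)) this).symm
    rw [h1]
    have h2 : HasSum (((F : Set (basisIndex H))ᶜ).indicator fun i => ‖S (e i)‖ ^ 2) (tail F) := by
      rw [htail]
      have := (hsum.indicator ((F : Set (basisIndex H))ᶜ)).hasSum
      rwa [← tsum_subtype] at this
    refine hasSum_le (fun i => ?_) (e.hasSum_norm_sq_diag (.indicator _ 1) (S x))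
      (h2.mul_right (‖x‖ ^ 2))
    by_cases hi : i ∈ F
    · simp [hi]
    · have h3 : ‖e.repr (S x) i‖ ≤ ‖S (e i)‖ * ‖x‖ := by
        rw [e.repr_apply_apply, ← hsymm]
        exact norm_inner_le_norm _ _
      have h4 := pow_le_pow_left₀ (norm_nonneg _) h3 2
      simpa [hi, mul_pow] using h4
  refine isCompactOperator_of_tendsto (l := atTop)
    (F := fun F : Finset (basisIndex H) => e.diag ((F : Set _).indicator fun _ => 1) * X) ?_
    (.of_forall fun F => (e.isCompactOperator_diag_indicator_finset F).comp_clm X)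
  rw [tendsto_iff_norm_sub_tendsto_zero]
  have hlim : Tendsto (fun F => √(tail F) * ‖A‖) atTop (𝓝 0) := by
    simpa using htail0.sqrt.mul_const ‖A‖
  refine squeeze_zero (fun _ => norm_nonneg _) (fun F => ?_) hlim
  rw [norm_sub_rev]
  refine ContinuousLinearMap.opNorm_le_bound _ (by positivity) fun x => ?_
  have ht0 : 0 ≤ tail F := tsum_nonneg fun i => by positivity
  have h5 := Real.sqrt_le_sqrt (hb F (A x))
  rw [Real.sqrt_sq (norm_nonneg _), Real.sqrt_mul ht0, Real.sqrt_sq (norm_nonneg _)] at h5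
  have h6 : S (A x) = X x := congrArg (fun T : H →L[ℂ] H => T x) hSA
  rw [h6] at h5
  refine h5.trans ?_
  rw [mul_assoc]
  exact mul_le_mul_of_nonneg_left (A.le_opNorm x) (by positivity)

universe u

open Module.End in
/-- A compact self-adjoint operator is diagonal in some Hilbert basis. -/
theorem exists_eq_diag_of_isCompactOperator {H : Type u} [NormedAddCommGroup H]
    [InnerProductSpace ℂ H] [CompleteSpace H] {X : H →L[ℂ] H} (hc : IsCompactOperator X)
    (hX : IsSelfAdjoint X) :
    ∃ (ι : Type u) (b : HilbertBasis ι ℂ H) (l : ι → ℝ), BoundedFamily l ∧ X = b.diag l := by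
  have hsymm := ContinuousLinearMap.isSelfAdjoint_iff_isSymmetric.mp hX
  have hclosed : ∀ μ : ℂ, IsClosed (eigenspace (X : H →ₗ[ℂ] H) μ : Set H) := fun μ => by
    have : (eigenspace (X : H →ₗ[ℂ] H) μ : Set H) = {x | X x = μ • x} := by
      ext x
      exact mem_eigenspace_iff
    rw [this]
    exact isClosed_eq X.continuous (continuous_const_smul μ)
  have hcomp : ∀ μ : ℂ, CompleteSpace (eigenspace (X : H →ₗ[ℂ] H) μ) := fun μ =>
    (hclosed μ).completeSpace_coe
  -- A Hilbert basis of every eigenspace, which is empty unless `μ` is an eigenvalue. Their union is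
  -- total by the spectral theorem for compact operators.
  choose w c hwc using fun μ : ℂ => exists_hilbertBasis ℂ (eigenspace (X : H →ₗ[ℂ] H) μ)
  let v : (Σ μ : ℂ, w μ) → H := fun i => (c i.1 i.2 : H)
  have hv : Orthonormal ℂ v :=
    hsymm.orthogonalFamily_eigenspaces.orthonormal_sigma_orthonormal fun μ => (c μ).orthonormal
  have hspan : (Submodule.span ℂ (Set.range v))ᗮ = ⊥ := by
    rw [eq_bot_iff, ← ContinuousLinearMap.orthogonalComplement_iSup_eigenspaces_eq_bot hc hsymm]
    intro x hx
    rw [← Submodule.iInf_orthogonal, Submodule.mem_iInf]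
    intro μ y hy
    have h1 := ((c μ).hasSum_repr ⟨y, hy⟩).mapL
      ((innerSL ℂ x).comp (eigenspace (X : H →ₗ[ℂ] H) μ).subtypeL)
    have h2 : ∀ i, ⟪x, (c μ i : H)⟫_ℂ = 0 := fun i =>
      Submodule.inner_left_of_mem_orthogonal
        (Submodule.subset_span (Set.mem_range_self (f := v) ⟨μ, i⟩)) hx
    have h3 : ⟪x, y⟫_ℂ = 0 := by
      refine h1.unique ?_
      simp [h2, hasSum_zero]
    rw [← inner_conj_symm, h3, map_zero]
  let b := HilbertBasis.mkOfOrthogonalEqBot hv hspan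
  have hb : ∀ i, b i = v i := fun i => by simp [b]
  have hXb : ∀ i : Σ μ : ℂ, w μ, X (b i) = i.1 • b i := fun i => by
    rw [hb]
    exact mem_eigenspace_iff.mp (c i.1 i.2).2
  have hne : ∀ i, b i ≠ 0 := fun i => b.orthonormal.ne_zero i
  have hre : ∀ i : Σ μ : ℂ, w μ, ((i.1.re : ℝ) : ℂ) = i.1 := fun i : Σ μ : ℂ, w μ => by
    rw [← Complex.conj_eq_iff_re]
    exact hsymm.conj_eigenvalue_eq_self
      (hasEigenvalue_of_hasEigenvector ⟨mem_eigenspace_iff.mpr (hXb i), hne i⟩)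
  have hl : BoundedFamily (fun i : Σ μ : ℂ, w μ => i.1.re) := by
    refine ⟨‖X‖, fun i => ?_⟩
    have h := X.le_opNorm (b i)
    rw [hXb i, norm_smul, b.orthonormal.norm_eq_one, mul_one, mul_one] at h
    exact (Complex.abs_re_le_norm _).trans h
  refine ⟨_, b, _, hl, b.eq_diag hl X fun x i => ?_⟩
  have h : ⟪X (b i), x⟫_ℂ = ⟪b i, X x⟫_ℂ := hsymm (b i) x
  rw [b.repr_apply_apply, b.repr_apply_apply, ← h, hXb, inner_smul_left, hre, ← hre i,
    Complex.conj_ofReal]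

namespace HilbertBasis

variable (b : HilbertBasis ι ℂ H) {f : ι → ℝ}

theorem abs_diag (hf : BoundedFamily f) : CFC.abs (b.diag f) = b.diag fun i => |f i| := by
  have hf' : BoundedFamily fun i => |f i| := hf.mono fun i => by simp
  have h : star (b.diag f) * b.diag f = (b.diag fun i => |f i|) * b.diag fun i => |f i| := by
    rw [(b.diag_isSelfAdjoint f).star_eq, b.diag_mul hf hf, b.diag_mul hf' hf']
    simp
  rw [CFC.abs, h]
  exact CFC.sqrt_mul_self _ (b.diag_nonneg fun i => abs_nonneg _)

theorem posPart_negPart_diag (hf : BoundedFamily f) :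
    (b.diag f)⁺ = b.diag (fun i => max (f i) 0) ∧ (b.diag f)⁻ = b.diag (fun i => max (-f i) 0) := by
  have h1 : BoundedFamily fun i => max (f i) 0 := hf.mono fun i => by
    rcases le_total (f i) 0 with h | h <;> simp [h]
  have h2 : BoundedFamily fun i => max (-f i) 0 := hf.mono fun i => by
    rcases le_total (f i) 0 with h | h <;> simp [h]
  refine CFC.posPart_negPart_unique ?_ ?_ (b.diag_nonneg fun i => le_max_right _ _)
    (b.diag_nonneg fun i => le_max_right _ _)
  · rw [b.diag_sub h1 h2]
    congr 1
    ext i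
    rcases le_total (f i) 0 with h | h <;> simp [h]
  · rw [b.diag_mul h1 h2, ← b.diag_zero]
    congr 1
    ext i
    rcases le_total (f i) 0 with h | h <;> simp [h]

/-- The trace of `|X|` is the same in the fixed basis, where it is finite by hypothesis, as in `b`,
where it is `∑ |f i|`. -/
theorem summable_of_isTraceClass_diag (hf : BoundedFamily f) (hT : IsTraceClass (b.diag f)) :
    Summable fun i => |f i| := by
  have hf' : BoundedFamily fun i => |f i| := hf.mono fun i => by simp
  rw [IsTraceClass, b.abs_diag hf] at hT
  have h := b.tsum_inner_diag (fixedBasis H) hf' fun i => abs_nonneg _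
  have h0 : ∀ x, 0 ≤ (⟪x, b.diag (fun i => |f i|) x⟫_ℂ).re := fun x =>
    (b.hasSum_inner_diag hf' x).nonneg fun i => by positivity
  rw [← ENNReal.ofReal_tsum_of_nonneg (fun k => h0 _) hT] at h
  have h2 : ∑' i, ENNReal.ofReal |f i| ≠ ∞ := h ▸ ENNReal.ofReal_ne_top
  have h3 := ENNReal.summable_toReal h2
  simpa using h3

end HilbertBasis
end

/-! ### Stable classes and evaluators on diagonal operators -/

noncomputable section

variable {H : Type*} [NormedAddCommGroup H] [InnerProductSpace ℂ H] [CompleteSpace H]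
  {ι : Type*} [Countable ι] {C : Set (H →L[ℂ] H)} {E : (H →L[ℂ] H) → ℝ≥0∞}
  (b : HilbertBasis ι ℂ H) {f g l : ι → ℝ} {s t : Set ι} {c : ℝ}

namespace IsStableClass

theorem diag_comp_mem (hC : IsStableClass C) (hl : BoundedFamily l) (h : b.diag l ∈ C)
    {φ : ℝ → ℝ} (hφ : IsBoundedBorel φ) : b.diag (φ ∘ l) ∈ C := by
  obtain ⟨-, M, hM⟩ := id hφ
  exact hC.borel _ h φ hφ _ (b.isBorelTransform_diag hl ⟨M, fun i => hM (l i)⟩)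

/-- The indicator of a single point is Borel, so `C` contains the spectral projections onto
eigenspaces and their multiples. -/
theorem diag_level_mem (hC : IsStableClass C) (hl : BoundedFamily l) (h : b.diag l ∈ C) (μ c : ℝ) :
    b.diag ({i | l i = μ}.indicator fun _ => c) ∈ C := by
  refine hC.diag_comp_mem b hl h (φ := ({μ} : Set ℝ).indicator fun _ => c)
    ⟨measurable_const.indicator (measurableSet_singleton μ), |c|, fun t => ?_⟩
  by_cases ht : t ∈ ({μ} : Set ℝ)
  · rw [Set.indicator_of_mem ht]
  · rw [Set.indicator_of_notMem ht, abs_zero]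
    exact abs_nonneg c

theorem diag_indicator_mem (hC : IsStableClass C) (h : b.diag (s.indicator fun _ => 1) ∈ C)
    (c : ℝ) : b.diag (s.indicator fun _ => c) ∈ C := by
  have h1 := hC.diag_level_mem b (.indicator s 1) h 1 c
  convert h1 using 3
  ext i
  by_cases hi : i ∈ s <;> simp [hi]

theorem diag_compl_mem (hC : IsStableClass C) (h : b.diag (s.indicator fun _ => 1) ∈ C) :
    b.diag (sᶜ.indicator fun _ => 1) ∈ C := by
  have h1 := hC.diag_level_mem b (.indicator s 1) h 0 1
  convert h1 using 3
  ext i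
  by_cases hi : i ∈ s <;> simp [hi]

theorem diag_max_mem (hC : IsStableClass C) (hl : BoundedFamily l) (h : b.diag l ∈ C) :
    b.diag (fun i => max (l i) 0) ∈ C := by
  obtain ⟨M, hM⟩ := id hl
  -- The stability axiom admits only functions bounded on all of `ℝ`, hence the cut-off at `|M|`,
  -- which does not affect the eigenvalues.
  convert hC.diag_comp_mem b hl h (φ := fun t => max (min t |M|) 0)
    ⟨by fun_prop, |M|, fun t => ?_⟩ using 2
  · ext i
    have : l i ≤ |M| := (le_abs_self _).trans ((hM i).trans (le_abs_self M))
    simp [this]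
  · rw [abs_of_nonneg (le_max_right _ _)]
    exact max_le (min_le_right _ _) (abs_nonneg M)

theorem diag_neg_mem (hC : IsStableClass C) (hl : BoundedFamily l) (h : b.diag l ∈ C) :
    b.diag (fun i => -l i) ∈ C := by
  obtain ⟨M, hM⟩ := id hl
  convert hC.diag_comp_mem b hl h (φ := fun t => -max (-|M|) (min t |M|))
    ⟨by fun_prop, |M|, fun t => ?_⟩ using 2
  · ext i
    have h1 := abs_le.1 ((hM i).trans (le_abs_self M))
    simp [h1.1, h1.2]
  · rw [abs_neg, abs_le]
    exact ⟨le_max_left _ _, max_le (neg_le_self (abs_nonneg M)) (min_le_right _ _)⟩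

omit [Countable ι] in
theorem diag_add_mem (hC : IsStableClass C) (hf : BoundedFamily f) (hg : BoundedFamily g)
    (hfg : ∀ i, f i * g i = 0) (h : b.diag f ∈ C) (h' : b.diag g ∈ C) :
    b.diag (fun i => f i + g i) ∈ C := by
  rw [← b.diag_add hf hg]
  refine hC.orthogonalSum _ h _ h' (actOnOrthogonal_of_mul_eq_zero (b.diag_isSelfAdjoint f)
    (b.diag_isSelfAdjoint g) ?_)
  rw [b.diag_mul hf hg, ← b.diag_zero]
  simp only [hfg]

omit [Countable ι] in
theorem diag_union_mem (hC : IsStableClass C) (hst : Disjoint s t)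
    (h : b.diag (s.indicator fun _ => c) ∈ C) (h' : b.diag (t.indicator fun _ => c) ∈ C) :
    b.diag ((s ∪ t).indicator fun _ => c) ∈ C := by
  convert hC.diag_add_mem b (.indicator s c) (.indicator t c) (fun i => ?_) h h' using 2
  · exact Set.indicator_union_of_disjoint hst _
  · by_cases hi : i ∈ s
    · simp [Set.disjoint_left.1 hst hi]
    · simp [hi]

end IsStableClass

namespace IsEvaluator

omit [Countable ι]

theorem diag_add (hC : IsStableClass C) (hE : IsEvaluator C E) (hf : BoundedFamily f)
    (hg : BoundedFamily g) (hfg : ∀ i, f i * g i = 0) (h : b.diag f ∈ C) (h' : b.diag g ∈ C) :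
    E (b.diag fun i => f i + g i) = E (b.diag f) + E (b.diag g) := by
  have h0 := hC.diag_add_mem b hf hg hfg h h'
  rw [← b.diag_add hf hg] at h0 ⊢
  refine hE.extensive _ h _ h' (actOnOrthogonal_of_mul_eq_zero (b.diag_isSelfAdjoint f)
    (b.diag_isSelfAdjoint g) ?_) h0
  rw [b.diag_mul hf hg, ← b.diag_zero]
  simp only [hfg]

theorem diag_union (hC : IsStableClass C) (hE : IsEvaluator C E) (hst : Disjoint s t)
    (h : b.diag (s.indicator fun _ => c) ∈ C) (h' : b.diag (t.indicator fun _ => c) ∈ C) :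
    E (b.diag ((s ∪ t).indicator fun _ => c)) =
      E (b.diag (s.indicator fun _ => c)) + E (b.diag (t.indicator fun _ => c)) := by
  rw [← diag_add b hC hE (.indicator s c) (.indicator t c) (fun i => ?_) h h']
  · congr 2
    exact Set.indicator_union_of_disjoint hst _
  · by_cases hi : i ∈ s
    · simp [Set.disjoint_left.1 hst hi]
    · simp [hi]

theorem diag_perm (hE : IsEvaluator C E) (σ : Equiv.Perm ι) (hf : BoundedFamily f)
    (h : b.diag f ∈ C) : b.diag (f ∘ σ) ∈ C ∧ E (b.diag (f ∘ σ)) = E (b.diag f) := by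
  obtain ⟨U, hU, hUf⟩ := b.exists_unitary_diag_comp σ
  rw [← hUf f hf]
  exact hE.unitary U hU _ h

open scoped Pointwise in
/-- Diagonal projections of equal finite rank are unitarily equivalent. -/
theorem diag_of_card_eq (hE : IsEvaluator C E) {s t : Finset ι} (hst : s.card = t.card)
    (h : b.diag ((s : Set ι).indicator fun _ => c) ∈ C) :
    b.diag ((t : Set ι).indicator fun _ => c) ∈ C ∧
      E (b.diag ((t : Set ι).indicator fun _ => c)) =
        E (b.diag ((s : Set ι).indicator fun _ => c)) := by
  classical
  -- Permutations act transitively on the subsets of given finite size, even when `ι` is infinite.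
  have := Set.powersetCard.isPretransitive (α := ι) (n := s.card)
  obtain ⟨σ, hσ⟩ := MulAction.exists_smul_eq (Equiv.Perm ι)
    (⟨t, hst.symm⟩ : Set.powersetCard ι s.card) ⟨s, rfl⟩
  have h1 : ∀ i, σ i ∈ s ↔ i ∈ t := fun i => by
    have h2 : σ • t = s := congrArg Subtype.val hσ
    rw [← h2]
    exact Finset.smul_mem_smul_finset_iff σ
  have h3 : ((s : Set ι).indicator fun _ => c) ∘ σ = (t : Set ι).indicator fun _ => c := by
    ext i
    simp only [Function.comp_apply, Set.indicator_apply, Finset.mem_coe, h1]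
  rw [← h3]
  exact hE.diag_perm b σ (.indicator _ c) h

theorem map_zero (hE : IsEvaluator C E) : E 0 = 0 := by
  simpa using (hE.scalar 0 le_rfl).2

theorem zero_mem (hE : IsEvaluator C E) : 0 ∈ C := by
  simpa using (hE.scalar 0 le_rfl).1

theorem diag_empty_mem (hE : IsEvaluator C E) (c : ℝ) :
    b.diag (((∅ : Finset ι) : Set ι).indicator fun _ => c) ∈ C ∧
      E (b.diag (((∅ : Finset ι) : Set ι).indicator fun _ => c)) = 0 := by
  have h : b.diag (((∅ : Finset ι) : Set ι).indicator fun _ => c) = 0 := by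
    simpa using b.diag_zero
  rw [h]
  exact ⟨hE.zero_mem, hE.map_zero⟩

end IsEvaluator
end

/-! ### Values on projections: infinite and finite dimension -/

noncomputable section

namespace HilbertBasis

variable {H : Type*} [NormedAddCommGroup H] [InnerProductSpace ℂ H] {ι κ : Type*}

theorem finiteDimensional [Finite ι] (b : HilbertBasis ι ℂ H) : FiniteDimensional ℂ H := by
  have := Fintype.ofFinite ι
  exact b.toOrthonormalBasis.toBasis.finiteDimensional_of_finite

theorem finite_index (b : HilbertBasis ι ℂ H) [FiniteDimensional ℂ H] : Finite ι :=
  b.orthonormal.linearIndependent.finite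

end HilbertBasis

variable {H : Type*} [NormedAddCommGroup H] [InnerProductSpace ℂ H] [CompleteSpace H]
  {ι : Type*} [Countable ι] {C : Set (H →L[ℂ] H)} {E : (H →L[ℂ] H) → ℝ≥0∞}
  (b : HilbertBasis ι ℂ H)

namespace IsEvaluator

/-- In infinite dimensions a stable class carrying an evaluator contains no nonzero projection of
finite rank. -/
theorem not_mem_of_infinite [Infinite ι] (hC : IsStableClass C) (hE : IsEvaluator C E)
    {s : Finset ι} (hs : s.Nonempty) : b.diag ((s : Set ι).indicator fun _ => 1) ∉ C := by
  classical
  intro h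
  obtain ⟨hι⟩ := nonempty_denumerable ι
  let e : ℕ ↪ ι := (Denumerable.eqv ι).symm.toEmbedding
  -- `T n` consists of the first `n` consecutive blocks of `s.card` indices in an enumeration; each
  -- block is a permuted copy of `s`.
  set T : ℕ → Finset ι := fun n => (Finset.range (n * s.card)).map e with hT
  have key : ∀ n : ℕ, b.diag ((T n : Set ι).indicator fun _ => 1) ∈ C ∧
      E (b.diag ((T n : Set ι).indicator fun _ => 1)) =
        n * E (b.diag ((s : Set ι).indicator fun _ => 1)) := by
    intro n
    induction n with
    | zero => simpa [hT] using hE.diag_empty_mem b 1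
    | succ n ih =>
      set B : Finset ι := (Finset.Ico (n * s.card) ((n + 1) * s.card)).map e with hB
      have hcard : s.card = B.card := by simp [hB, add_mul]
      obtain ⟨hBC, hBE⟩ := hE.diag_of_card_eq b hcard h
      have hu : (T (n + 1) : Set ι) = (T n : Set ι) ∪ (B : Set ι) := by
        have hr : Finset.range ((n + 1) * s.card) =
            Finset.range (n * s.card) ∪ Finset.Ico (n * s.card) ((n + 1) * s.card) := by
          ext k
          simp only [Finset.mem_range, Finset.mem_union, Finset.mem_Ico]
          have : n * s.card ≤ (n + 1) * s.card := Nat.mul_le_mul_right _ (Nat.le_succ n)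
          omega
        rw [← Finset.coe_union, hB, ← Finset.map_union, ← hr]
      have hd : Disjoint (T n : Set ι) B := by
        rw [Finset.disjoint_coe, hT, hB, Finset.disjoint_map, Finset.disjoint_left]
        intro k hk hk'
        simp only [Finset.mem_range, Finset.mem_Ico] at hk hk'
        omega
      rw [hu, diag_union b hC hE hd ih.1 hBC, ih.2, hBE]
      exact ⟨hC.diag_union_mem b hd ih.1 hBC, by push_cast; ring⟩
  have hle : ∀ n : ℕ, n * E (b.diag ((s : Set ι).indicator fun _ => 1)) ≤ E 1 := fun n => by
    have h1 := diag_union b hC hE disjoint_compl_right (key n).1 (hC.diag_compl_mem b (key n).1)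
    rw [Set.union_compl_self, Set.indicator_univ, b.diag_one, (key n).2] at h1
    rw [h1]
    exact le_self_add
  have hzero : E (b.diag ((s : Set ι).indicator fun _ => 1)) = 0 := by
    by_contra hne
    obtain ⟨n, hn⟩ := ENNReal.exists_nat_mul_gt hne hE.one_lt_top.ne
    exact absurd (hle n) (not_le.2 hn)
  have hbd : ∀ (s : Set ι) (i : ι), |s.indicator (fun _ => (1 : ℝ)) i| ≤ 1 := fun s i => by
    by_cases h : i ∈ s <;> simp [h]
  -- The `T n` exhaust `ι`, so their projections tend strongly to `1`, dominated by `1`, whose value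
  -- is finite.
  have hlim := hE.dominated (fun n => b.diag ((T n : Set ι).indicator fun _ => 1)) 1 1
    (fun n => (key n).1) hE.one_mem hE.one_mem
    (fun n => b.diag_nonneg fun i => Set.indicator_nonneg (by simp) i)
    (by rw [← b.diag_one]; exact b.diag_nonneg fun _ => zero_le_one)
    (fun n => by
      rw [← b.diag_one]
      exact b.diag_mono (.indicator _ 1) (.const 1) fun i => (le_abs_self _).trans (hbd _ i))
    (fun x => by
      rw [← b.diag_one]
      refine b.tendsto_diag (M := 1) (fun _ => hbd _) (fun _ => by simp) (fun i => ?_) x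
      refine tendsto_const_nhds.congr' ?_
      filter_upwards [eventually_gt_atTop (Denumerable.eqv ι i)] with n hn
      refine (Set.indicator_of_mem (s := (T n : Set ι)) ?_ fun _ => (1 : ℝ)).symm
      rw [Finset.mem_coe, hT, Finset.mem_map]
      refine ⟨Denumerable.eqv ι i, Finset.mem_range.2 (hn.trans_le ?_), by simp [e]⟩
      exact Nat.le_mul_of_pos_right n hs.card_pos)
    hE.one_lt_top
  simp only [(key _).2, hzero, mul_zero] at hlim
  exact hE.one_pos.ne (tendsto_nhds_unique tendsto_const_nhds hlim)

/-- On the finite-rank projections of a stable class, an evaluator is proportional to the rank. -/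
theorem card_mul_diag (hC : IsStableClass C) (hE : IsEvaluator C E) (c : ℝ) {s t : Finset ι}
    (hs : b.diag ((s : Set ι).indicator fun _ => 1) ∈ C)
    (ht : b.diag ((t : Set ι).indicator fun _ => 1) ∈ C) :
    s.card * E (b.diag ((t : Set ι).indicator fun _ => c)) =
      t.card * E (b.diag ((s : Set ι).indicator fun _ => c)) := by
  classical
  -- Subtractive Euclidean algorithm: a copy `s'` of the smaller set is removed from the larger one.
  induction hn : s.card + t.card using Nat.strong_induction_on generalizing s t with
  | _ n ih =>
    subst hn
    wlog hst : s.card ≤ t.card generalizing s t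
    · refine (this ht hs (fun m hm s t hs ht h => ih m ?_ hs ht h) (le_of_not_ge hst)).symm
      rwa [add_comm]
    rcases s.eq_empty_or_nonempty with rfl | hne
    · rw [(hE.diag_empty_mem b c).2]
      simp
    obtain ⟨s', hs't, hs'⟩ := Finset.exists_subset_card_eq hst
    have h1 := (hE.diag_of_card_eq b hs'.symm hs).1
    have hcs := hC.diag_indicator_mem b hs c
    obtain ⟨h2, h3⟩ := hE.diag_of_card_eq b hs'.symm hcs
    -- The class is not assumed closed under differences, but `t \ s'` is the complement of the
    -- disjoint union `s' ∪ tᶜ`.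
    have hu : b.diag (((t \ s' : Finset ι) : Set ι).indicator fun _ => 1) ∈ C := by
      have hd : Disjoint (s' : Set ι) (t : Set ι)ᶜ :=
        Set.disjoint_compl_right_iff_subset.2 (by exact_mod_cast hs't)
      have := hC.diag_compl_mem b (hC.diag_union_mem b hd h1 (hC.diag_compl_mem b ht))
      rwa [Set.compl_union, compl_compl, Set.inter_comm, ← Set.sdiff_eq, ← Finset.coe_sdiff] at this
    have hcu := hC.diag_indicator_mem b hu c
    have hd : Disjoint (s' : Set ι) ((t \ s' : Finset ι) : Set ι) := by
      rw [Finset.disjoint_coe]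
      exact Finset.disjoint_sdiff
    have h4 := diag_union b hC hE hd h2 hcu
    rw [← Finset.coe_union, Finset.union_sdiff_of_subset hs't, h3] at h4
    have hcard : (t \ s').card + s.card = t.card := by
      rw [← hs', Finset.card_sdiff_add_card_eq_card hs't]
    have h5 := ih (s.card + (t \ s').card) (by have := hne.card_pos; omega) hs hu rfl
    rw [h4, mul_add, h5, ← hcard]
    push_cast
    ring

/-- In finite dimensions an evaluator is proportional to the trace on positive operators. -/
theorem card_mul_diag_of_nonneg [Fintype ι] (hC : IsStableClass C) (hE : IsEvaluator C E)
    {f : ι → ℝ} (hf : ∀ i, 0 ≤ f i) (h : b.diag f ∈ C) :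
    Fintype.card ι * E (b.diag f) = ENNReal.ofReal (∑ i, f i) * E 1 := by
  classical
  have hlevel : ∀ μ, 0 ≤ μ →
      Fintype.card ι * E (b.diag ({i | f i = μ}.indicator fun _ => μ)) =
        ENNReal.ofReal (∑ i, {i | f i = μ}.indicator (fun _ => μ) i) * E 1 := fun μ hμ => by
    have h1 := hC.diag_level_mem b (.of_finite f) h μ 1
    have e : {i | f i = μ} = ((Finset.univ.filter fun i => f i = μ : Finset ι) : Set ι) := by simp
    rw [e] at h1 ⊢
    have h2 : b.diag (((Finset.univ : Finset ι) : Set ι).indicator fun _ => 1) ∈ C := by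
      rw [Finset.coe_univ, Set.indicator_univ, b.diag_one]
      exact hE.one_mem
    -- Comparison with the full index set, where normalization supplies the value at `μ ≥ 0`.
    have h3 := hE.card_mul_diag b hC μ h2 h1
    rw [Finset.coe_univ, Set.indicator_univ, b.diag_const, (hE.scalar μ hμ).2,
      Finset.card_univ] at h3
    rw [h3, ← mul_assoc, ← ENNReal.ofReal_natCast, ← ENNReal.ofReal_mul (by positivity)]
    congr 2
    simp [Set.indicator_apply, ← Finset.sum_filter]
  have key : ∀ F : Finset ℝ, b.diag ({i | f i ∈ F}.indicator f) ∈ C ∧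
      Fintype.card ι * E (b.diag ({i | f i ∈ F}.indicator f)) =
        ENNReal.ofReal (∑ i, {i | f i ∈ F}.indicator f i) * E 1 := by
    intro F
    induction F using Finset.induction_on with
    | empty =>
      have : b.diag ({i | f i ∈ (∅ : Finset ℝ)}.indicator f) = 0 := by simpa using b.diag_zero
      rw [this]
      exact ⟨hE.zero_mem, by simp [hE.map_zero]⟩
    | insert μ F hμ ih =>
      have hsplit : ∀ i, {i | f i ∈ insert μ F}.indicator f i =
          {i | f i = μ}.indicator (fun _ => μ) i + {i | f i ∈ F}.indicator f i := fun i => by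
        by_cases h1 : f i = μ
        · simp [h1, hμ]
        · simp [Set.indicator_apply, h1]
      have hmul : ∀ i, {i | f i = μ}.indicator (fun _ => μ) i * {i | f i ∈ F}.indicator f i = 0 :=
        fun i => by
          by_cases h1 : f i = μ
          · simp [h1, hμ]
          · simp [Set.indicator_apply, h1]
      rw [show {i | f i ∈ insert μ F}.indicator f = fun i => {i | f i = μ}.indicator (fun _ => μ) i +
        {i | f i ∈ F}.indicator f i from funext hsplit]
      have h1 := hC.diag_level_mem b (.of_finite f) h μ μ
      refine ⟨hC.diag_add_mem b (.of_finite _) (.of_finite _) hmul h1 ih.1, ?_⟩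
      rw [diag_add b hC hE (.of_finite _) (.of_finite _) hmul h1 ih.1, mul_add, ih.2,
        Finset.sum_add_distrib]
      -- The set `F` may contain negative numbers; these are not values of `f`, and their level sets
      -- are empty.
      by_cases hne : ∃ i, f i = μ
      · obtain ⟨i, hi⟩ := hne
        have hμ0 : 0 ≤ μ := hi ▸ hf i
        rw [hlevel μ hμ0, ENNReal.ofReal_add, add_mul]
        · exact Finset.sum_nonneg fun i _ => Set.indicator_nonneg (fun _ _ => hμ0) i
        · exact Finset.sum_nonneg fun i _ => Set.indicator_nonneg (fun i _ => hf i) i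
      · push Not at hne
        have : {i | f i = μ} = ∅ := by ext i; simp [hne i]
        simp [this, b.diag_zero, hE.map_zero]
  have h1 := (key (Finset.univ.image f)).2
  have h2 : {i | f i ∈ Finset.univ.image f} = Set.univ := by ext i; simp
  rwa [h2, Set.indicator_univ] at h1

/-- Positive and negative parts both lie in `C` and have finite values, so the subtraction in
`EReal` is one of real numbers. -/
theorem signedValue_diag [Fintype ι] [Nonempty ι] (hC : IsStableClass C) (hE : IsEvaluator C E)
    {f : ι → ℝ} (h : b.diag f ∈ C) :
    signedValue E (b.diag f) = (((E 1).toReal / Fintype.card ι * ∑ i, f i : ℝ) : EReal) := by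
  have hf := BoundedFamily.of_finite f
  have hN : (0 : ℝ) < Fintype.card ι := by exact_mod_cast Fintype.card_pos
  have key : ∀ g : ι → ℝ, (∀ i, 0 ≤ g i) → b.diag g ∈ C →
      E (b.diag g) = ENNReal.ofReal ((E 1).toReal / Fintype.card ι * ∑ i, g i) := by
    intro g hg hgC
    have h1 := hE.card_mul_diag_of_nonneg b hC hg hgC
    rw [← ENNReal.ofReal_toReal hE.one_lt_top.ne, ← ENNReal.ofReal_mul
      (Finset.sum_nonneg fun i _ => hg i)] at h1
    have h2 : ENNReal.ofReal ((∑ i, g i) * (E 1).toReal) =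
        Fintype.card ι * ENNReal.ofReal ((E 1).toReal / Fintype.card ι * ∑ i, g i) := by
      rw [← ENNReal.ofReal_natCast, ← ENNReal.ofReal_mul hN.le]
      congr 1
      field_simp
    rw [h2] at h1
    exact (ENNReal.mul_right_inj (by exact_mod_cast Fintype.card_ne_zero)
      (ENNReal.natCast_ne_top _)).1 h1
  obtain ⟨hp, hn⟩ := b.posPart_negPart_diag hf
  have hnonneg : ∀ g : ι → ℝ, (∀ i, 0 ≤ g i) →
      0 ≤ (E 1).toReal / Fintype.card ι * ∑ i, g i := fun g hg =>
    mul_nonneg (by positivity) (Finset.sum_nonneg fun i _ => hg i)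
  rw [signedValue, hp, hn,
    key _ (fun i => le_max_right _ _) (hC.diag_max_mem b hf h),
    key _ (fun i => le_max_right _ _) (hC.diag_max_mem b (.of_finite _) (hC.diag_neg_mem b hf h)),
    EReal.coe_ennreal_ofReal, EReal.coe_ennreal_ofReal,
    max_eq_left (hnonneg _ fun i => le_max_right _ _),
    max_eq_left (hnonneg _ fun i => le_max_right _ _), ← EReal.coe_sub, ← mul_sub,
    ← Finset.sum_sub_distrib]
  congr 2
  refine Finset.sum_congr rfl fun i _ => ?_
  rcases le_total (f i) 0 with h | h <;> simp [h]

end IsEvaluator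
end

/-! ### Borel calculus and trace of scalar operators -/

noncomputable section

variable {H : Type*} [NormedAddCommGroup H] [InnerProductSpace ℂ H] [CompleteSpace H]

namespace ProjectionValuedMeasure

variable (P : ProjectionValuedMeasure H) {B : Set ℝ} {x : H}

theorem scalarMeasure_apply (x : H) (hB : MeasurableSet B) :
    P.scalarMeasure x B = ENNReal.ofReal (⟪x, P.proj B x⟫_ℂ).re :=
  Measure.ofMeasurable_apply B hB

theorem scalarMeasure_univ (x : H) : P.scalarMeasure x Set.univ = ENNReal.ofReal (‖x‖ ^ 2) := by
  rw [P.scalarMeasure_apply x MeasurableSet.univ, P.proj_univ]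
  congr 1
  exact inner_self_eq_norm_sq (𝕜 := ℂ) x

instance isFiniteMeasure_scalarMeasure (x : H) : IsFiniteMeasure (P.scalarMeasure x) :=
  ⟨by rw [P.scalarMeasure_univ]; exact ENNReal.ofReal_lt_top⟩

theorem scalarMeasure_real_univ (x : H) : (P.scalarMeasure x).real Set.univ = ‖x‖ ^ 2 := by
  rw [Measure.real, P.scalarMeasure_univ, ENNReal.toReal_ofReal (by positivity)]

/-- A set on one side of `t` is null for the spectral measure of the scalar operator `t`. -/
theorem proj_eq_zero_of_scalar {t σ : ℝ}
    (hP : P.IsSpectralMeasureOf (boundedPMap ((t : ℂ) • (1 : H →L[ℂ] H))))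
    (hB : MeasurableSet B) (hσ : ∀ s ∈ B, 0 < σ * (s - t)) : P.proj B = 0 := by
  ext x
  -- The measure of `y` is carried by `B` and has mean `t`. So `σ * (s - t)` is positive almost
  -- everywhere with integral `0`, which forces the measure, and hence `y`, to vanish.
  set y := P.proj B x with hy
  set μ := P.scalarMeasure y with hμ
  have hint : Integrable (fun s : ℝ => s) μ := by
    have h1 : ∫⁻ s, ENNReal.ofReal (s ^ 2) ∂μ < ∞ := (hP.1 y).1 Submodule.mem_top
    have h2 : MemLp (fun s : ℝ => s) 2 μ := by
      rw [memLp_two_iff_integrable_sq (f := fun s : ℝ => s) measurable_id.aestronglyMeasurable]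
      refine ⟨by fun_prop, ?_⟩
      rw [hasFiniteIntegral_iff_ofReal (.of_forall fun s => sq_nonneg s)]
      exact h1
    exact h2.integrable one_le_two
  have hmean : ∫ s, s ∂μ = t * ‖y‖ ^ 2 := by
    have h1 := hP.2 ⟨y, Submodule.mem_top⟩
    have h2 : ⟪y, (t : ℂ) • y⟫_ℂ = ((∫ s, s ∂μ : ℝ) : ℂ) := h1
    rw [inner_smul_right, inner_self_eq_norm_sq_to_K] at h2
    apply Complex.ofReal_injective
    rw [← h2]
    simp
  have hzero : ∫ s, σ * (s - t) ∂μ = 0 := by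
    rw [integral_const_mul, integral_sub hint (integrable_const t), hmean, integral_const,
      P.scalarMeasure_real_univ]
    simp [mul_comm]
  have hae : ∀ᵐ s ∂μ, s ∈ B := by
    have h1 : μ Bᶜ = 0 := by
      rw [hμ, P.scalarMeasure_apply y hB.compl, hy]
      have h2 : P.proj Bᶜ (P.proj B x) = P.proj (Bᶜ ∩ B) x := by
        rw [P.proj_inter _ _ hB.compl hB]; rfl
      rw [h2, Set.compl_inter_self, P.proj_empty]
      simp
    exact h1
  have h3 : (fun s => σ * (s - t)) =ᵐ[μ] 0 :=
    (integral_eq_zero_iff_of_nonneg_ae (hae.mono fun s hs => (hσ s hs).le)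
      ((hint.sub (integrable_const t)).const_mul σ)).1 hzero
  have h4 : μ Set.univ = 0 := by
    have h5 : ∀ᵐ s ∂μ, False := by
      filter_upwards [h3, hae] with s h6 h7
      exact (hσ s h7).ne' h6
    rwa [ae_iff, not_false_eq_true] at h5
  rw [hμ, P.scalarMeasure_univ, ENNReal.ofReal_eq_zero] at h4
  have h5 : ‖y‖ = 0 := by nlinarith [norm_nonneg y]
  simpa using h5

/-- The Borel calculus of a scalar operator is evaluation. -/
theorem inner_of_isIntegral_scalar {t : ℝ} {g : ℝ → ℝ} {A : H →L[ℂ] H}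
    (hP : P.IsSpectralMeasureOf (boundedPMap ((t : ℂ) • (1 : H →L[ℂ] H))))
    (hA : P.IsIntegral g A) (x : H) : ⟪x, A x⟫_ℂ = ((g t * ‖x‖ ^ 2 : ℝ) : ℂ) := by
  have h1 : P.proj (Set.Ioi t) = 0 :=
    P.proj_eq_zero_of_scalar (σ := 1) hP measurableSet_Ioi fun s hs => by
      simpa using hs
  have h2 : P.proj (Set.Iio t) = 0 :=
    P.proj_eq_zero_of_scalar (σ := -1) hP measurableSet_Iio fun s hs => by
      simpa using hs
  have h3 : ∀ᵐ s ∂(P.scalarMeasure x), s = t := by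
    have h4 : P.scalarMeasure x (Set.Ioi t) = 0 := by
      rw [P.scalarMeasure_apply x measurableSet_Ioi, h1]; simp
    have h5 : P.scalarMeasure x (Set.Iio t) = 0 := by
      rw [P.scalarMeasure_apply x measurableSet_Iio, h2]; simp
    filter_upwards [measure_eq_zero_iff_ae_notMem.1 h4, measure_eq_zero_iff_ae_notMem.1 h5]
      with s h6 h7
    exact le_antisymm (not_lt.1 h6) (not_lt.1 h7)
  rw [(hA x).2]
  congr 1
  rw [integral_congr_ae (h3.mono fun s hs => (by rw [hs] : g s = g t)), integral_const,
    P.scalarMeasure_real_univ, smul_eq_mul, mul_comm]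

end ProjectionValuedMeasure

/-- In the uniqueness claim the spectral measure of `t • 1` is an arbitrary one, so the trace must
be shown independent of that choice. -/
theorem opTrace_of_isBorelTransform_scalar [Fintype (basisIndex H)] {t : ℝ} {g : ℝ → ℝ}
    {A : H →L[ℂ] H} (hA : IsBorelTransform (boundedPMap ((t : ℂ) • (1 : H →L[ℂ] H))) g A) :
    (opTrace A).re = Fintype.card (basisIndex H) * g t := by
  obtain ⟨P, hP, hPA⟩ := hA
  simp [opTrace, P.inner_of_isIntegral_scalar hP hPA, (fixedBasis H).orthonormal.norm_eq_one]

theorem opTrace_diag {ι : Type*} [Fintype ι] [Fintype (basisIndex H)] (b : HilbertBasis ι ℂ H)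
    (f : ι → ℝ) : (opTrace (b.diag f)).re = ∑ i, f i := by
  have h1 : opTrace (b.diag f) = ∑ i, (f i : ℂ) := by
    have h2 := (b.diag f : H →ₗ[ℂ] H).trace_eq_sum_inner (fixedBasis H).toOrthonormalBasis
    have h3 := (b.diag f : H →ₗ[ℂ] H).trace_eq_sum_inner b.toOrthonormalBasis
    rw [opTrace, tsum_fintype]
    rw [h2] at h3
    simp only [HilbertBasis.coe_toOrthonormalBasis, ContinuousLinearMap.coe_coe] at h3
    rw [h3]
    refine Finset.sum_congr rfl fun i _ => ?_
    rw [b.diag_apply_basis (.of_finite f), inner_smul_right, inner_self_eq_norm_sq_to_K,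
      b.orthonormal.norm_eq_one]
    simp
  simp [h1]

/-! ### The trace formula on the trace-class part, and uniqueness -/

theorem signedValue_of_nonneg {C : Set (H →L[ℂ] H)} {E : (H →L[ℂ] H) → ℝ≥0∞}
    (hE : IsEvaluator C E) {X : H →L[ℂ] H} (hX : 0 ≤ X) : signedValue E X = E X := by
  rw [signedValue, (CFC.posPart_eq_self X).2 hX, (CFC.negPart_eq_zero_iff X).2 hX, hE.map_zero]
  simp

/-- A trace-class operator in the class is diagonal in some Hilbert basis. -/
theorem IsStableClass.exists_eq_diag.{u} {H : Type u} [NormedAddCommGroup H]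
    [InnerProductSpace ℂ H] [CompleteSpace H] {C : Set (H →L[ℂ] H)} (hC : IsStableClass C)
    {X : H →L[ℂ] H} (hX : X ∈ C) (hT : IsTraceClass X) :
    ∃ (ι : Type u) (b : HilbertBasis ι ℂ H) (l : ι → ℝ), BoundedFamily l ∧ X = b.diag l :=
  exists_eq_diag_of_isCompactOperator (hT.isCompactOperator (hC.isSelfAdjoint X hX))
    (hC.isSelfAdjoint X hX)

/-- In infinite dimensions a class carrying an evaluator has no nonzero trace-class element. -/
theorem IsEvaluator.eq_zero_of_isTraceClass [TopologicalSpace.SeparableSpace H]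
    {C : Set (H →L[ℂ] H)} {E : (H →L[ℂ] H) → ℝ≥0∞} (hC : IsStableClass C) (hE : IsEvaluator C E)
    (hH : ¬ FiniteDimensional ℂ H) {X : H →L[ℂ] H} (hX : X ∈ C) (hT : IsTraceClass X) : X = 0 := by
  obtain ⟨ι, b, l, hl, rfl⟩ := hC.exists_eq_diag hX hT
  have := b.countable_index
  have : Infinite ι := not_finite_iff_infinite.1 fun _ => hH b.finiteDimensional
  have hl0 : ∀ i, l i = 0 := by
    by_contra! hne
    obtain ⟨i, hi⟩ := hne
    -- Summable eigenvalues tend to `0`, so a nonzero one has finite multiplicity.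
    have hfin : {j | l j = l i}.Finite := by
      have h1 := (b.summable_of_isTraceClass_diag hl hT).tendsto_cofinite_zero.eventually_lt_const
        (abs_pos.2 hi)
      refine Set.Finite.subset h1 fun j hj => ?_
      have hj' : l j = l i := hj
      simp [hj']
    have h2 := hC.diag_level_mem b hl hX (l i) 1
    rw [← hfin.coe_toFinset] at h2
    exact hE.not_mem_of_infinite b hC ⟨i, by simp⟩ h2
  rw [← b.diag_zero]
  congr 1
  exact funext hl0

/-- Every trace-class element of the class satisfies the trace formula with the identity function. -/
theorem IsEvaluator.exists_eqTraceForm_id [TopologicalSpace.SeparableSpace H]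
    {C : Set (H →L[ℂ] H)} {E : (H →L[ℂ] H) → ℝ≥0∞} (hC : IsStableClass C) (hE : IsEvaluator C E) :
    ∃ c : ℝ, 0 < c ∧
      ∀ X ∈ C, IsTraceClass X → EqTraceForm (signedValue E X) c (fun t => t) X := by
  have hborel : ∀ X ∈ C, IsTraceClass X → IsBorelTransform (boundedPMap X) (fun t => t) X := by
    intro X hX hT
    obtain ⟨ι, b, l, hl, rfl⟩ := hC.exists_eq_diag hX hT
    have := b.countable_index
    exact b.isBorelTransform_diag hl (g := fun t => t) hl
  by_cases hH : FiniteDimensional ℂ H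
  · have := (fixedBasis H).finite_index
    have := Fintype.ofFinite (basisIndex H)
    have : Nonempty (basisIndex H) := by
      by_contra hne
      have := not_nonempty_iff.1 hne
      have h1 : (1 : H →L[ℂ] H) = 0 := by
        rw [← (fixedBasis H).diag_one, ← (fixedBasis H).diag_zero]
        congr 1
        exact funext isEmptyElim
      exact hE.one_pos.ne' (h1 ▸ hE.map_zero)
    have hpos : 0 < (E 1).toReal := ENNReal.toReal_pos hE.one_pos.ne' hE.one_lt_top.ne
    refine ⟨(E 1).toReal / Fintype.card (basisIndex H), by positivity, fun X hX hT =>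
      ⟨X, hborel X hX hT, hT, ?_⟩⟩
    obtain ⟨ι, b, l, hl, rfl⟩ := hC.exists_eq_diag hX hT
    have := b.finite_index
    have := Fintype.ofFinite ι
    have hcard : Fintype.card ι = Fintype.card (basisIndex H) := by
      rw [← Module.finrank_eq_card_basis b.toOrthonormalBasis.toBasis,
        ← Module.finrank_eq_card_basis (fixedBasis H).toOrthonormalBasis.toBasis]
    have : Nonempty ι := Fintype.card_pos_iff.1 (hcard ▸ Fintype.card_pos)
    rw [opTrace_diag, hE.signedValue_diag b hC hX, hcard]
  -- Only `X = 0` remains, so any positive constant would do.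
  · refine ⟨1, zero_lt_one, fun X hX hT => ⟨X, hborel X hX hT, hT, ?_⟩⟩
    rw [hE.eq_zero_of_isTraceClass hC hH hX hT, signedValue_of_nonneg hE le_rfl, hE.map_zero]
    simp [opTrace]

/-- Real multiples of the identity operator lie in the class. -/
theorem IsEvaluator.scalar_mem [TopologicalSpace.SeparableSpace H]
    {C : Set (H →L[ℂ] H)} {E : (H →L[ℂ] H) → ℝ≥0∞} (hC : IsStableClass C) (hE : IsEvaluator C E)
    (t : ℝ) : (t : ℂ) • (1 : H →L[ℂ] H) ∈ C := by
  have := (fixedBasis H).countable_index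
  have h1 : (fixedBasis H).diag (fun _ => 1) ∈ C := by
    rw [(fixedBasis H).diag_one]
    exact hE.one_mem
  have h2 := hC.diag_comp_mem (fixedBasis H) (.const 1) h1 (φ := fun _ => t)
    ⟨measurable_const, |t|, fun _ => le_rfl⟩
  rw [← (fixedBasis H).diag_const]
  exact h2

theorem isTraceClass_of_finiteDimensional [FiniteDimensional ℂ H] (T : H →L[ℂ] H) :
    IsTraceClass T := by
  have := (fixedBasis H).finite_index
  exact Summable.of_finite

end
theorem theorem3p1 {H : Type*} [NormedAddCommGroup H] [InnerProductSpace ℂ H] [CompleteSpace H]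
    [TopologicalSpace.SeparableSpace H] (C : Set (H →L[ℂ] H)) (E : (H →L[ℂ] H) → ℝ≥0∞)
    (hC : IsStableClass C) (hE : IsEvaluator C E) :
    ∃ (h : ℝ → ℝ) (c : ℝ), Measurable h ∧ Monotone h ∧ h 0 = 0 ∧ 0 < c ∧
      (∀ X ∈ C, IsTraceClass X → 0 ≤ X → EqTraceForm (E X : EReal) c h X) ∧
      (∀ D : H →ₗ.[ℂ] H, IsSelfAdjoint D → ∀ f : ℝ → ℝ, IsBoundedBorel f →
        ∀ X, IsBorelTransform D f X → X ∈ C → IsTraceClass X →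
          EqTraceForm (signedValue E X) c h X) ∧
      ((∃ X ∈ C, IsTraceClass X ∧ X ≠ 0) →
        ∀ (h' : ℝ → ℝ) (c' : ℝ), Measurable h' → Monotone h' → 0 < c' →
          (∀ X ∈ C, IsTraceClass X → EqTraceForm (signedValue E X) c' h' X) →
          ∃ a b : ℝ, 0 < a ∧ (∀ t, h' t = a * h t + b) ∧ c' = c / a) := by
  obtain ⟨c, hc, hform⟩ := hE.exists_eqTraceForm_id hC
  refine ⟨fun t => t, c, measurable_id, monotone_id, rfl, hc, fun X hX hT h0 => ?_,
    fun D _ f _ X _ hX hT => hform X hX hT, ?_⟩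
  · rw [← signedValue_of_nonneg hE h0]
    exact hform X hX hT
  · rintro ⟨X, hX, hT, hne⟩ h' c' - - hc' hform'
    have hH : FiniteDimensional ℂ H := by
      by_contra hH
      exact hne (hE.eq_zero_of_isTraceClass hC hH hX hT)
    have := (fixedBasis H).finite_index
    have := Fintype.ofFinite (basisIndex H)
    have hN : (Fintype.card (basisIndex H) : ℝ) ≠ 0 := by
      intro h0
      have hempty := Fintype.card_eq_zero_iff.1 (by exact_mod_cast h0)
      exact hne (ContinuousLinearMap.ext fun x => (fixedBasis H).repr_ext isEmptyElim)
    -- The two formulas on `t • 1` give `N * c * t = N * c' * h' t` with `N` the dimension, hence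
    -- slope `c / c'` and no constant term.
    refine ⟨c / c', 0, div_pos hc hc', fun t => ?_, by field_simp⟩
    have hmem := hE.scalar_mem hC t
    have htr := isTraceClass_of_finiteDimensional ((t : ℂ) • (1 : H →L[ℂ] H))
    obtain ⟨A, hA, -, hvA⟩ := hform _ hmem htr
    obtain ⟨A', hA', -, hvA'⟩ := hform' _ hmem htr
    rw [opTrace_of_isBorelTransform_scalar hA] at hvA
    rw [opTrace_of_isBorelTransform_scalar hA', hvA, EReal.coe_eq_coe_iff] at hvA'
    field_simp
    refine mul_left_cancel₀ hN ?_
    linarith
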